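/- For a finite simple graph $G$ and an integer $\ell\ge 1$, an $\ell$-ranking of $G$ is a colouring $\varphi:V(G)\to\mathbb{N}$ such that every path $u_0,\ldots,u_p$ in $G$ with $1\le p\le\ell$ edges satisfies $\varphi(u_0)\ne\varphi(u_p)$ or $\varphi(u_0)<\max\{\varphi(u_0),\ldots,\varphi(u_p)\}$; the $\ell$-ranking number $\chi_\ell(G)$ is the least integer $k$ such that $G$ has an $\ell$-ranking $\varphi:V(G)\to\{1,\ldots,k\}$. Let $\log$ be the natural logarithm, $\log^{(0)}x:=x$ and $\log^{(i)}x:=\log(\log^{(i-1)}x)$ for $i\ge 1$. **Theorem.** (a) For all fixed integers $\ell\ge 2$ and $t\ge 0$, every $n$-vertex graph $H$ of treewidth at most $t$ has $\chi_\ell(H)\in O(\log n/\log^{(t+1)}n)$. That is, there are constants $C$ and $n_0$, depending only on $\ell$ and $t$, such that $\chi_\ell(H)\le C\log n/\log^{(t+1)}n$ for every $n\ge n_0$ and every $n$-vertex graph $H$ of treewidth at most $t$. (b) This is asymptotically optimal: for every fixed integer $t\ge 0$ there is a constant $c>0$, depending only on $t$, such that for infinitely many values of $n$ there exists an $n$-vertex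 graph $H$ of treewidth exactly $t$ with $\chi_2(H)\ge c\log n/\log^{(t+1)}n$. -/

import Mathlib

namespace SimpleGraph

/-- A colouring `φ : V → ℕ` is an `ℓ`-ranking of `G` if for every path `u = u₀, …, u_p = v` of `G`
with `1 ≤ p ≤ ℓ` edges, either `φ u₀ ≠ φ u_p`, or `φ u₀ < max {φ u₀, …, φ u_p}`
(that is, some vertex `w` of the path has `φ u₀ < φ w`). -/
def IsRanking {V : Type*} (G : SimpleGraph V) (ℓ : ℕ) (φ : V → ℕ) : Prop :=
  ∀ (u v : V) (p : G.Walk u v), p.IsPath → 1 ≤ p.length → p.length ≤ ℓ →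
    φ u ≠ φ v ∨ ∃ w ∈ p.support, φ u < φ w

/-- The `ℓ`-ranking number of a finite graph: the least `k` such that the graph has an `ℓ`-ranking
with colours in `{1, …, k}`. (Such `k` exist for finite graphs: use pairwise distinct colours.) -/
noncomputable def rankingNumber {V : Type*} (G : SimpleGraph V) (ℓ : ℕ) : ℕ :=
  sInf {k : ℕ | ∃ φ : V → ℕ, (∀ v, φ v ∈ Finset.Icc 1 k) ∧ G.IsRanking ℓ φ}

/-- A tree decomposition of a finite graph `G`: bags indexed by the nodes of a finite tree, such that
the nodes whose bags contain a given vertex induce a connected (in particular nonempty) subgraph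
of the tree, and both ends of each edge of `G` lie in a common bag. -/
structure TreeDecomposition {V : Type*} (G : SimpleGraph V) where
  /-- The nodes of the decomposition tree. -/
  Node : Type
  [fintypeNode : Fintype Node]
  /-- The decomposition tree. -/
  tree : SimpleGraph Node
  isTree : tree.IsTree
  /-- The bags. -/
  bag : Node → Finset V
  connected_induce : ∀ v : V, (tree.induce {x | v ∈ bag x}).Connected
  exists_bag_of_adj : ∀ v w : V, G.Adj v w → ∃ x, v ∈ bag x ∧ w ∈ bag x

attribute [instance] TreeDecomposition.fintypeNode

/-- The width of a tree decomposition: the maximum size of a bag, minus one. -/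
def TreeDecomposition.width {V : Type*} {G : SimpleGraph V} (D : G.TreeDecomposition) : ℤ :=
  ((Finset.univ.sup fun x => (D.bag x).card : ℕ) : ℤ) - 1

/-- The treewidth of a finite graph: the minimum width of a tree decomposition of it.
(Widths are at least `-1`, and the tree with one node whose bag contains all vertices always gives
a tree decomposition, so that the infimum is a minimum.) -/
noncomputable def treewidth {V : Type*} (G : SimpleGraph V) : ℤ :=
  sInf {w : ℤ | ∃ D : G.TreeDecomposition, D.width = w}

end SimpleGraph

/-- The iterated natural logarithm: `iteratedLog 0 x = x`, and
`iteratedLog (i + 1) x = log (iteratedLog i x)`. -/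
noncomputable def iteratedLog : ℕ → ℝ → ℝ
  | 0, x => x
  | i + 1, x => Real.log (iteratedLog i x)

/-!
Graphs of treewidth at most `t` are the subgraphs of chordal graphs with an elimination order in
which every vertex has at most `t` back neighbours. On a chordal graph, a walk may be shortcut at
an interior vertex that comes after both of its neighbours, so a ranking has to be checked only on
"valleys": two chains of back neighbours from the ends of the walk to a common ancestor.

**Upper bound.** The induction on `t` (`ColorBound.succ`) bounds the number of colours in terms of
a superadditive weight on the elimination forest, at first the number of descendants. This weight
can be divided, unlike a number of vertices. Split the graph into breadth-first layers; a
vertex has at most `t - 1` back neighbours in its own layer, and layers are told apart modulo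
`ℓ + 1`. Fix `D` and let the rank of `v` be `⌊log_D w(v)⌋`. Within a layer the vertices of a given
rank inherit the weight `w / D ^ rank ≤ D`, so that the case `t - 1` colours them with few colours,
and these colours are placed in a block of their own. The blocks are ordered by a deficit that
grows as the rank falls inside a component of a layer. On entering a component in the next layer
the deficit grows by one, so that the vertices above the component protect it, unless the ranks of
the component roots did not change during the last `ℓ + 1` layers. In that exceptional case it does
not grow, and the vertices adjacent to the component from above ("ports") get colours higher than
all blocks. By superadditivity at most `t D` ports of one layer lie below a component `ℓ` layers
higher, so they can be given distinct colours. The growth by one is paid for by changes of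
rank, hence there are `O(log_D n)` blocks (`IsElimination.exists_deficit`). With `D = ⌊√log n⌋` the
bound for `t - 1` turns into the one for `t`.

**Lower bound.** `ExistsHardGraph.succ` joins every vertex `l` to `d` copies of a graph that is hard
for `t`, to a depth `s`. If fewer than `d` colours are used, one of the copies has all its
colours below that of `l`, so the colour of `l` exceeds the lowest colour in that copy by at least
the number `h` of colours that the copy needs. Hence the root has colour at least `h s`. The
treewidth of the resulting graphs cannot be smaller than claimed, because that would contradict the
upper bound.
-/

/-! ### Elimination orders -/

/-- `B u v` reads "`u` is a back neighbour of `v`". The relation is an acyclic orientation of a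
chordal graph: `ord` strictly increases along `B`, any two back neighbours of a vertex are equal or
adjacent, and no vertex has more than `t` back neighbours. Two vertices may share a value of `ord`
when they are not adjacent. -/
structure IsElimination {V : Type*} (B : V → V → Prop) (ord : V → ℕ) (t : ℕ) : Prop where
  ord_lt : ∀ {u v}, B u v → ord u < ord v
  clique : ∀ {u v w}, B u w → B v w → u = v ∨ B u v ∨ B v u
  card_le : ∀ v, {u | B u v}.ncard ≤ t

/-- `Chain B A k a u`: there is a chain `a = x₀, x₁, …, x_k = u` with `B xᵢ xᵢ₊₁` and all `xᵢ`
in `A`. -/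
inductive Chain {V : Type*} (B : V → V → Prop) (A : V → Prop) : ℕ → V → V → Prop
  | single {a : V} : A a → Chain B A 0 a a
  | snoc {k : ℕ} {a v u : V} : Chain B A k a v → B v u → A u → Chain B A (k + 1) a u

/-- The ranking condition tested only on walks that first descend from `u` to `a` and then ascend
to `v` in the elimination order. -/
def IsValleyRanking {V : Type*} (B : V → V → Prop) (ℓ : ℕ) (φ : V → ℕ) : Prop :=
  ∀ (a u v : V) (i j : ℕ), i + j ≤ ℓ → φ u = φ v →
    Chain B (fun x => φ x ≤ φ u) i a u → Chain B (fun x => φ x ≤ φ u) j a v → u = v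

/-- A superadditive weight on the elimination forest. -/
structure IsWeight {V : Type*} (B : V → V → Prop) (w : V → ℕ) : Prop where
  one_le : ∀ v, 1 ≤ w v
  sum_le : ∀ (a : V) (S : Finset V), (∀ s ∈ S, Relation.ReflTransGen B a s) →
    (∀ s ∈ S, ∀ s' ∈ S, Relation.ReflTransGen B s s' → s = s') → ∑ s ∈ S, w s ≤ w a

namespace Chain

variable {V : Type*} {B : V → V → Prop} {A : V → Prop}

theorem mem_bot {k : ℕ} {a u : V} (h : Chain B A k a u) : A u := by
  cases h <;> assumption

theorem mem_top {k : ℕ} {a u : V} (h : Chain B A k a u) : A a := by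
  induction h <;> assumption

theorem reflTransGen {k : ℕ} {a u : V} (h : Chain B A k a u) : Relation.ReflTransGen B a u := by
  induction h with
  | single => exact .refl
  | snoc _ hb _ ih => exact ih.tail hb

theorem cons {k : ℕ} {b a u : V} (hb : A b) (hba : B b a) (h : Chain B A k a u) :
    Chain B A (k + 1) b u := by
  induction h with
  | single ha => exact .snoc (.single hb) hba ha
  | snoc _ hv hu ih => exact .snoc (ih hba) hv hu

theorem imp {A' : V → Prop} (hA : ∀ x, A x → A' x) {k : ℕ} {a u : V} (h : Chain B A k a u) :
    Chain B A' k a u := by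
  induction h with
  | single ha => exact .single (hA _ ha)
  | snoc _ hb hu ih => exact .snoc ih hb (hA _ hu)

end Chain

namespace IsElimination

variable {V : Type*} {B : V → V → Prop} {ord : V → ℕ} {t : ℕ}

theorem ord_le (h : IsElimination B ord t) {u v : V} (huv : Relation.ReflTransGen B u v) :
    ord u ≤ ord v := by
  induction huv with
  | refl => rfl
  | tail _ hb ih => exact ih.trans (h.ord_lt hb).le

/-- A step down followed by an ascent can be straightened to a valley. -/
theorem valley_of_step (h : IsElimination B ord t) {A : V → Prop} {u : V} (hu : A u) :
    ∀ (i : ℕ) {j : ℕ} {a x v : V}, Chain B A i a x → B u x → Chain B A j a v →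
      ∃ a' i' j', i' + j' ≤ i + 1 + j ∧ Chain B A i' a' u ∧ Chain B A j' a' v := by
  intro i
  induction i with
  | zero =>
    intro j a x v hx hux hv
    cases hx
    exact ⟨u, 0, j + 1, by omega, .single hu, hv.cons hu hux⟩
  | succ i ih =>
    intro j a x v hx hux hv
    cases hx with
    | snoc hy hyx hx =>
      rename_i y
      rcases h.clique hux hyx with rfl | huy | hyu
      · exact ⟨a, i, j, by omega, hy, hv⟩
      · obtain ⟨a', i', j', hl, h1, h2⟩ := ih hy huy hv
        exact ⟨a', i', j', by omega, h1, h2⟩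
      · exact ⟨a, i + 1, j, by omega, .snoc hy hyu hu, hv⟩

theorem exists_valley (h : IsElimination B ord t) {G : SimpleGraph V}
    (hG : ∀ u v, G.Adj u v → B u v ∨ B v u) {A : V → Prop} {u v : V} (p : G.Walk u v)
    (hp : ∀ x ∈ p.support, A x) :
    ∃ a i j, i + j ≤ p.length ∧ Chain B A i a u ∧ Chain B A j a v := by
  induction p with
  | nil => exact ⟨_, 0, 0, by simp, .single (hp _ (by simp)), .single (hp _ (by simp))⟩
  | @cons u x v hux p ih =>
    obtain ⟨a, i, j, hl, h1, h2⟩ := ih fun y hy => hp y (by simp [hy])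
    have hu : A u := hp u (by simp)
    rcases hG _ _ hux with hb | hb
    · obtain ⟨a', i', j', hl', h1', h2'⟩ := h.valley_of_step hu i h1 hb h2
      exact ⟨a', i', j', by simp; omega, h1', h2'⟩
    · exact ⟨a, i + 1, j, by simp; omega, .snoc h1 hb hu, h2⟩

/-- On a chordal graph only valleys matter, since a walk can be shortcut at every interior vertex
that comes after both of its neighbours. -/
theorem isRanking (h : IsElimination B ord t) {G : SimpleGraph V}
    (hG : ∀ u v, G.Adj u v → B u v ∨ B v u) {ℓ : ℕ} {φ : V → ℕ} (hφ : IsValleyRanking B ℓ φ) :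
    G.IsRanking ℓ φ := by
  intro u v p hp h1 hl
  by_contra! hc
  obtain ⟨a, i, j, hij, hu, hv⟩ := h.exists_valley hG (A := fun x => φ x ≤ φ u) p hc.2
  obtain rfl := hφ a u v i j (hij.trans hl) hc.1 hu hv
  rw [SimpleGraph.Walk.isPath_iff_nil, ← SimpleGraph.Walk.length_eq_zero_iff] at hp
  omega

theorem ancestors_comparable (h : IsElimination B ord t) :
    ∀ (n : ℕ) {u v x : V}, ord x ≤ n → Relation.ReflTransGen B u x → Relation.ReflTransGen B v x →
      Relation.ReflTransGen B u v ∨ Relation.ReflTransGen B v u := by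
  intro n
  induction n with
  | zero =>
    intro u v x hx hu hv
    rcases Relation.ReflTransGen.cases_tail hu with rfl | ⟨y, _, hy⟩
    · exact .inr hv
    · have := h.ord_lt hy; omega
  | succ n ih =>
    intro u v x hx hu hv
    rcases Relation.ReflTransGen.cases_tail hu with rfl | ⟨y, huy, hy⟩
    · exact .inr hv
    rcases Relation.ReflTransGen.cases_tail hv with rfl | ⟨z, hvz, hz⟩
    · exact .inl hu
    have h1 := h.ord_lt hy
    have h2 := h.ord_lt hz
    rcases h.clique hy hz with rfl | hyz | hzy
    · exact ih (by omega) huy hvz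
    · exact ih (by omega) (huy.tail hyz) hvz
    · exact ih (by omega) huy (hvz.tail hzy)

/-- The number of descendants is a weight. -/
theorem isWeight_ncard [Finite V] (h : IsElimination B ord t) :
    IsWeight B fun v => {x | Relation.ReflTransGen B v x}.ncard := by
  classical
  have := Fintype.ofFinite V
  refine ⟨fun v => ?_, fun a S ha hS => ?_⟩
  · exact (Set.ncard_pos).2 ⟨v, .refl⟩
  · simp only [Set.ncard_eq_toFinset_card']
    rw [← Finset.card_biUnion]
    · apply Finset.card_le_card
      intro x hx
      simp only [Finset.mem_biUnion, Set.mem_toFinset, Set.mem_ofPred_eq] at hx ⊢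
      obtain ⟨s, hs, hx⟩ := hx
      exact (ha s hs).trans hx
    · intro s hs s' hs' hne
      refine Finset.disjoint_left.2 ?_
      intro x hx hx'
      simp only [Set.mem_toFinset, Set.mem_ofPred_eq] at hx hx'
      rcases h.ancestors_comparable _ le_rfl hx hx' with hh | hh
      · exact hne (hS s hs s' hs' hh)
      · exact hne (hS s' hs' s hs hh).symm

/-- Parents in the elimination forest: `p v` is the last back neighbour of `v`. -/
theorem exists_parent [Finite V] (h : IsElimination B ord t) :
    ∃ p : V → V, ∀ u v, B u v → B (p v) v ∧ (u = p v ∨ B u (p v)) := by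
  have : ∀ v, ∃ q, ∀ u, B u v → B q v ∧ (u = q ∨ B u q) := by
    intro v
    by_cases hv : ∃ u, B u v
    · obtain ⟨q, hq, hmax⟩ := Set.exists_max_image {u | B u v} ord (Set.toFinite _) hv
      refine ⟨q, fun u hu => ⟨hq, ?_⟩⟩
      rcases h.clique hu hq with h1 | h1 | h1
      · exact .inl h1
      · exact .inr h1
      · exact absurd (hmax u hu) (not_le.2 (h.ord_lt h1))
    · exact ⟨v, fun u hu => absurd ⟨u, hu⟩ hv⟩
  choose p hp using this
  exact ⟨p, fun u v => hp v u⟩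

theorem exists_first [Finite V] (h : IsElimination B ord t) :
    ∃ p : V → V, ∀ u v, B u v → B (p v) v ∧ (u = p v ∨ B (p v) u) := by
  have : ∀ v, ∃ q, ∀ u, B u v → B q v ∧ (u = q ∨ B q u) := by
    intro v
    by_cases hv : ∃ u, B u v
    · obtain ⟨q, hq, hmin⟩ := Set.exists_min_image {u | B u v} ord (Set.toFinite _) hv
      refine ⟨q, fun u hu => ⟨hq, ?_⟩⟩
      rcases h.clique hu hq with h1 | h1 | h1
      · exact .inl h1
      · exact absurd (hmin u hu) (not_le.2 (h.ord_lt h1))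
      · exact .inr h1
    · exact ⟨v, fun u hu => absurd ⟨u, hu⟩ hv⟩
  choose p hp using this
  exact ⟨p, fun u v => hp v u⟩

/-- Recursion along a map `q` that goes back in the elimination order. -/
theorem exists_rec {α : Type*} (ord : V → ℕ) (c : V → Prop) (q : V → V)
    (hq : ∀ v, c v → ord (q v) < ord v) (base : V → α) (step : V → α → α) :
    ∃ g : V → α, ∀ v, (c v → g v = step v (g (q v))) ∧ (¬ c v → g v = base v) := by
  classical
  have wf : WellFounded fun u v : V => ord u < ord v := (measure ord).wf
  let F : ∀ v, (∀ u, ord u < ord v → α) → α :=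
    fun v rec => if hv : c v then step v (rec (q v) (hq v hv)) else base v
  refine ⟨wf.fix F, fun v => ⟨fun hv => ?_, fun hv => ?_⟩⟩
  · rw [wf.fix_eq]; simp only [F, dif_pos hv]
  · rw [wf.fix_eq]; simp only [F, dif_neg hv]

/-- Breadth-first layers: back neighbours lie in the same or in the preceding layer, and a vertex
with a back neighbour has one in the preceding layer. -/
theorem exists_layer [Finite V] (h : IsElimination B ord t) :
    ∃ L : V → ℕ, ∀ u v, B u v → (L u = L v ∨ L u + 1 = L v) ∧ ∃ u', B u' v ∧ L u' + 1 = L v := by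
  obtain ⟨f, hf⟩ := h.exists_first
  obtain ⟨L, hL⟩ := exists_rec (α := ℕ) ord (fun v => ∃ u, B u v) f
    (fun v ⟨u, hu⟩ => h.ord_lt (hf u v hu).1) (fun _ => 0) (fun _ n => n + 1)
  have key : ∀ n u v, ord v ≤ n → B u v → L u = L v ∨ L u + 1 = L v := by
    intro n
    induction n with
    | zero => intro u v hv hb; have := h.ord_lt hb; omega
    | succ n ih =>
      intro u v hv hb
      have h1 := (hL v).1 ⟨u, hb⟩
      have h2 := h.ord_lt hb
      rcases (hf u v hb).2 with h3 | h3
      · rw [h3]; omega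
      · have := ih _ u (by omega) h3; omega
  exact ⟨L, fun u v hb => ⟨key _ u v le_rfl hb, f v, (hf u v hb).1, ((hL v).1 ⟨u, hb⟩).symm⟩⟩

end IsElimination

/-! ### Layer components -/

/-- `p` is the parent map of the elimination forest and `L` a breadth-first layering. -/
structure IsLayering {V : Type*} (B : V → V → Prop) (p : V → V) (L : V → ℕ) : Prop where
  parent : ∀ {u v}, B u v → B (p v) v ∧ (u = p v ∨ B u (p v))
  layer : ∀ {u v}, B u v → L u = L v ∨ L u + 1 = L v
  exists_prev : ∀ {u v}, B u v → ∃ u', B u' v ∧ L u' + 1 = L v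

/-- `A v j` is the root of the layer component `j` layers above the one containing `v`; the
sequence becomes constant when there is no further layer. -/
structure IsComponentRoot {V : Type*} (B : V → V → Prop) (L : V → ℕ) (A : V → ℕ → V) : Prop where
  same : ∀ {u v}, B u v → L u = L v → A u = A v
  next : ∀ {u v}, B u v → L u + 1 = L v → ∀ j, A v (j + 1) = A u j
  root : ∀ v, A (A v 0) = A v
  layer_root : ∀ v, L (A v 0) = L v
  anc : ∀ v j, Relation.ReflTransGen B (A v j) v
  anc_succ : ∀ v j, Relation.ReflTransGen B (A v (j + 1)) (A v j)
  /-- The vertices above a component that have a neighbour in it are adjacent to its root. -/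
  attach : ∀ {u v}, B u v → L u + 1 = L v → B u (A v 0)

namespace IsElimination

variable {V : Type*} {B : V → V → Prop} {ord : V → ℕ} {t : ℕ} {p : V → V} {L : V → ℕ}

theorem exists_layering [Finite V] (h : IsElimination B ord t) : ∃ p L, IsLayering B p L := by
  obtain ⟨p, hp⟩ := h.exists_parent
  obtain ⟨L, hL⟩ := h.exists_layer
  exact ⟨p, L, fun hb => hp _ _ hb, fun hb => (hL _ _ hb).1, fun hb => (hL _ _ hb).2⟩

/-- Induction along the parent map. -/
theorem parent_induction (h : IsElimination B ord t) (hp : IsLayering B p L) {P : V → Prop}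
    (base : ∀ v, (∀ u, ¬ B u v) → P v)
    (same : ∀ v, B (p v) v → L (p v) = L v → P (p v) → P v)
    (next : ∀ v, B (p v) v → L (p v) + 1 = L v → P (p v) → P v) (v : V) : P v := by
  have key : ∀ n v, ord v ≤ n → P v := by
    intro n
    induction n with
    | zero =>
      intro v hv
      exact base v fun u hu => by have := h.ord_lt hu; omega
    | succ n ih =>
      intro v hv
      by_cases hb : ∃ u, B u v
      · obtain ⟨u, hu⟩ := hb
        have hpv := (hp.parent hu).1
        have := ih (p v) (by have := h.ord_lt hpv; omega)
        rcases hp.layer hpv with h1 | h1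
        · exact same v hpv h1 this
        · exact next v hpv h1 this
      · exact base v fun u hu => hb ⟨u, hu⟩
  exact key _ v le_rfl

theorem exists_componentRoot (h : IsElimination B ord t) (hp : IsLayering B p L) :
    ∃ A, IsComponentRoot B L A := by
  obtain ⟨A, hA⟩ := exists_rec (α := ℕ → V) ord (fun v => ∃ u, B u v) p
    (fun v ⟨u, hu⟩ => h.ord_lt (hp.parent hu).1) (fun v _ => v)
    (fun v a => if L (p v) = L v then a else fun j => Nat.casesOn j v a)
  have hbase : ∀ v, (∀ u, ¬ B u v) → ∀ j, A v j = v := fun v hv j => by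
    rw [(hA v).2 fun ⟨u, hu⟩ => hv u hu]
  have hsame : ∀ v, B (p v) v → L (p v) = L v → A v = A (p v) := fun v hv hl => by
    rw [(hA v).1 ⟨_, hv⟩, if_pos hl]
  have hnext0 : ∀ v, B (p v) v → L (p v) + 1 = L v → A v 0 = v := fun v hv hl => by
    rw [(hA v).1 ⟨_, hv⟩, if_neg (by omega)]; rfl
  have hnext : ∀ v, B (p v) v → L (p v) + 1 = L v → ∀ j, A v (j + 1) = A (p v) j :=
    fun v hv hl j => by
      rw [(hA v).1 ⟨_, hv⟩, if_neg (by omega)]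
  have same : ∀ v, ∀ u, B u v → L u = L v → A u = A v := by
    refine h.parent_induction hp (fun v hv u hu => absurd hu (hv u)) ?_ ?_
    · intro v hv hl ih u hu hul
      rw [hsame v hv hl]
      rcases (hp.parent hu).2 with rfl | h2
      · rfl
      · exact ih u h2 (hul.trans hl.symm)
    · intro v hv hl ih u hu hul
      rcases (hp.parent hu).2 with rfl | h2
      · omega
      · rcases hp.layer h2 with h3 | h3 <;> omega
  have next : ∀ v, ∀ u, B u v → L u + 1 = L v → ∀ j, A v (j + 1) = A u j := by
    refine h.parent_induction hp (fun v hv u hu => absurd hu (hv u)) ?_ ?_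
    · intro v hv hl ih u hu hul
      rw [hsame v hv hl]
      rcases (hp.parent hu).2 with rfl | h2
      · omega
      · exact ih u h2 (by omega)
    · intro v hv hl ih u hu hul j
      rw [hnext v hv hl]
      rcases (hp.parent hu).2 with rfl | h2
      · rfl
      · rw [same _ u h2 (by omega)]
  have layer_root : ∀ v, L (A v 0) = L v := by
    refine h.parent_induction hp (fun v hv => by rw [hbase v hv]) ?_ ?_
    · intro v hv hl ih
      rw [hsame v hv hl, ih, hl]
    · intro v hv hl ih
      rw [hnext0 v hv hl]
  have root : ∀ v, A (A v 0) = A v := by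
    refine h.parent_induction hp (fun v hv => by rw [hbase v hv]) ?_ ?_
    · intro v hv hl ih
      rw [hsame v hv hl, ih]
    · intro v hv hl ih
      rw [hnext0 v hv hl]
  have anc : ∀ v j, Relation.ReflTransGen B (A v j) v := by
    refine h.parent_induction hp (fun v hv j => by rw [hbase v hv]) ?_ ?_
    · intro v hv hl ih j
      rw [hsame v hv hl]
      exact (ih j).tail hv
    · intro v hv hl ih j
      cases j with
      | zero => rw [hnext0 v hv hl]
      | succ j => rw [hnext v hv hl]; exact (ih j).tail hv
  have anc_succ : ∀ v j, Relation.ReflTransGen B (A v (j + 1)) (A v j) := by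
    refine h.parent_induction hp (fun v hv j => by rw [hbase v hv, hbase v hv]) ?_ ?_
    · intro v hv hl ih j
      rw [hsame v hv hl]
      exact ih j
    · intro v hv hl ih j
      cases j with
      | zero => rw [hnext0 v hv hl]; exact anc v 1
      | succ j => rw [hnext v hv hl, hnext v hv hl]; exact ih j
  have attach : ∀ v, ∀ u, B u v → L u + 1 = L v → B u (A v 0) := by
    refine h.parent_induction hp (fun v hv u hu => absurd hu (hv u)) ?_ ?_
    · intro v hv hl ih u hu hul
      rw [hsame v hv hl]
      rcases (hp.parent hu).2 with rfl | h2
      · omega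
      · exact ih u h2 (by omega)
    · intro v hv hl ih u hu hul
      rwa [hnext0 v hv hl]
  exact ⟨A, same _ _, next _ _, root, layer_root, anc, anc_succ, attach _ _⟩

end IsElimination

namespace IsLayering

variable {V : Type*} {B : V → V → Prop} {p : V → V} {L : V → ℕ} {A : V → ℕ → V}

theorem layer_mono (hp : IsLayering B p L) {u v : V} (huv : Relation.ReflTransGen B u v) :
    L u ≤ L v := by
  induction huv with
  | refl => rfl
  | tail _ hb ih => rcases hp.layer hb with h | h <;> omega

theorem root_eq_of_anc (hp : IsLayering B p L) (hA : IsComponentRoot B L A) {u v : V}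
    (huv : Relation.ReflTransGen B u v) (hl : L u = L v) : A u = A v := by
  induction huv with
  | refl => rfl
  | tail hux hb ih =>
    have h1 := hp.layer_mono hux
    rcases hp.layer hb with h | h
    · rw [ih (hl.trans h.symm), hA.same hb h]
    · omega

theorem root_of_chain (hp : IsLayering B p L) (hA : IsComponentRoot B L A) {P : V → Prop} {k : ℕ}
    {a u : V} (hc : Chain B P k a u) :
    ∃ d ≤ k, L u = L a + d ∧ ∀ j, A u (d + j) = A a j := by
  induction hc with
  | single => exact ⟨0, le_rfl, rfl, fun j => by rw [zero_add]⟩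
  | snoc _ hb _ ih =>
    obtain ⟨d, hd, hl, hj⟩ := ih
    rcases hp.layer hb with h | h
    · exact ⟨d, by omega, by omega, fun j => by rw [← hA.same hb h, hj]⟩
    · refine ⟨d + 1, by omega, by omega, fun j => ?_⟩
      rw [add_right_comm, hA.next hb h, hj]

end IsLayering

namespace IsWeight

variable {V : Type*} {B : V → V → Prop} {w : V → ℕ}

theorem mono (hw : IsWeight B w) {u v : V} (huv : Relation.ReflTransGen B u v) : w v ≤ w u := by
  simpa using hw.sum_le u {v} (by simpa using huv) (by simp)

theorem log_mono (hw : IsWeight B w) (D : ℕ) {u v : V} (huv : Relation.ReflTransGen B u v) :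
    Nat.log D (w v) ≤ Nat.log D (w u) :=
  Nat.log_mono_right (hw.mono huv)

end IsWeight

/-! ### Restriction to a layer and to a weight class -/

/-- The part of `B` inside the classes of equal layer and equal rank. -/
def restrictClass {V : Type*} (B : V → V → Prop) (L r : V → ℕ) (u v : V) : Prop :=
  B u v ∧ L u = L v ∧ r u = r v

section restrictClass

variable {V : Type*} {B : V → V → Prop} {ord : V → ℕ} {t : ℕ} {p : V → V} {L : V → ℕ}

/-- Every vertex with a back neighbour loses one of them, in the preceding layer. -/
theorem IsElimination.restrictClass [Finite V] (h : IsElimination B ord (t + 1))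
    (hp : IsLayering B p L) (r : V → ℕ) : IsElimination (restrictClass B L r) ord t := by
  refine ⟨fun hb => h.ord_lt hb.1, ?_, fun v => ?_⟩
  · rintro u v w ⟨hu, hu1, hu2⟩ ⟨hv, hv1, hv2⟩
    rcases h.clique hu hv with h1 | h1 | h1
    · exact .inl h1
    · exact .inr (.inl ⟨h1, by omega, by omega⟩)
    · exact .inr (.inr ⟨h1, by omega, by omega⟩)
  · by_cases hv : ∃ u, B u v
    · obtain ⟨u, hu⟩ := hv
      obtain ⟨u', hu', hl⟩ := hp.exists_prev hu
      have : {u | _root_.restrictClass B L r u v}.ncard < {u | B u v}.ncard := by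
        refine Set.ncard_lt_ncard ⟨fun x hx => hx.1, fun hs => ?_⟩ (Set.toFinite _)
        have := (hs hu' : _root_.restrictClass B L r u' v).2.1
        omega
      have := h.card_le v
      omega
    · have : {u | _root_.restrictClass B L r u v} = ∅ :=
        Set.eq_empty_of_forall_notMem fun u hu => hv ⟨u, hu.1⟩
      simp [this]

theorem reflTransGen_of_restrictClass {r : V → ℕ} {u v : V}
    (huv : Relation.ReflTransGen (restrictClass B L r) u v) :
    Relation.ReflTransGen B u v ∧ L u = L v ∧ r u = r v := by
  induction huv with
  | refl => exact ⟨.refl, rfl, rfl⟩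
  | tail _ hb ih => exact ⟨ih.1.tail hb.1, ih.2.1.trans hb.2.1, ih.2.2.trans hb.2.2⟩

theorem reflTransGen_restrictClass (hp : IsLayering B p L) {r : V → ℕ}
    (hr : ∀ {u v}, Relation.ReflTransGen B u v → r v ≤ r u) {u v : V}
    (huv : Relation.ReflTransGen B u v) (hl : L u = L v) (hruv : r u = r v) :
    Relation.ReflTransGen (restrictClass B L r) u v := by
  induction huv with
  | refl => exact .refl
  | @tail x v hux hb ih =>
    have h1 := hp.layer_mono hux
    have h2 := hp.layer_mono (.single hb)
    have h3 := hr hux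
    have h4 := hr (.single hb)
    exact (ih (by omega) (by omega)).tail ⟨hb, by omega, by omega⟩

/-- Dividing by the unit of the rank gives a weight on each class, with values below `D`. -/
theorem IsWeight.restrictClass (hp : IsLayering B p L) {w : V → ℕ} (hw : IsWeight B w) {D : ℕ}
    (hD : 1 < D) :
    IsWeight (restrictClass B L fun v => Nat.log D (w v))
      fun v => w v / D ^ Nat.log D (w v) := by
  have hpos : ∀ n, 0 < D ^ n := fun n => pow_pos (by omega) n
  refine ⟨fun v => ?_, fun a S ha hS => ?_⟩
  · rw [Nat.one_le_div_iff (hpos _)]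
    exact Nat.pow_log_le_self D (Nat.one_le_iff_ne_zero.1 (hw.one_le v))
  · have hr : ∀ s ∈ S, L a = L s ∧ Nat.log D (w a) = Nat.log D (w s) := fun s hs =>
      (reflTransGen_of_restrictClass (ha s hs)).2
    have hsum : ∑ s ∈ S, w s ≤ w a := by
      refine hw.sum_le a S (fun s hs => (reflTransGen_of_restrictClass (ha s hs)).1) ?_
      intro s hs s' hs' hss
      exact hS s hs s' hs' <| reflTransGen_restrictClass hp (hw.log_mono D) hss
        ((hr s hs).1.symm.trans (hr s' hs').1) ((hr s hs).2.symm.trans (hr s' hs').2)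
    rw [Finset.sum_congr rfl fun s hs => by rw [← (hr s hs).2], Nat.le_div_iff_mul_le (hpos _),
      Finset.sum_mul]
    exact (Finset.sum_le_sum fun s _ => Nat.div_mul_le_self _ _).trans hsum

end restrictClass

/-! ### Deficits and ports -/

/-- `u` is a port if some component attached to `u` in the next layer is such that the roots of the
`ℓ + 2` components above it (itself included) all have the same rank. -/
def IsPort {V : Type*} (B : V → V → Prop) (L : V → ℕ) (A : V → ℕ → V) (r : V → ℕ) (ℓ : ℕ)
    (u : V) : Prop :=
  ∃ v, B u v ∧ L u + 1 = L v ∧ r (A v (ℓ + 1)) ≤ r (A v 0)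

section deficit

variable {V : Type*} {B : V → V → Prop} {ord : V → ℕ} {t : ℕ} {p : V → V} {L : V → ℕ}
  {A : V → ℕ → V}

/-- The deficit `y` counts the losses of rank within layer components, plus one for every step
into a component for which the rank of the root has changed within the last `ℓ + 1` layers. The
sum of the ranks of the vertex and of the last `ℓ + 1` roots pays for these steps, whence the
bound. -/
theorem IsElimination.exists_deficit (h : IsElimination B ord t) (hp : IsLayering B p L)
    (hA : IsComponentRoot B L A) {r : V → ℕ}
    (hr : ∀ {u v}, Relation.ReflTransGen B u v → r v ≤ r u) {R : ℕ} (hR : ∀ v, r v ≤ R) (ℓ : ℕ) :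
    ∃ y : V → ℕ, (∀ u v, B u v → L u = L v → y v = y u + (r u - r v)) ∧
      (∀ u v, B u v → L u + 1 = L v → r (A v 0) < r (A v (ℓ + 1)) → y u < y v) ∧
      ∀ v, y v ≤ (ℓ + 2) * R := by
  obtain ⟨y, hy⟩ := exists_rec (α := ℕ) ord (fun v => ∃ u, B u v) p
    (fun v ⟨u, hu⟩ => h.ord_lt (hp.parent hu).1) (fun _ => 0)
    (fun v n => if L (p v) = L v then n + (r (p v) - r v)
      else if r (A v 0) < r (A v (ℓ + 1)) then n + 1 else n)
  have hsame : ∀ v, B (p v) v → L (p v) = L v → y v = y (p v) + (r (p v) - r v) :=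
    fun v hv hl => by rw [(hy v).1 ⟨_, hv⟩, if_pos hl]
  have hnext : ∀ v, B (p v) v → L (p v) + 1 = L v →
      y v = if r (A v 0) < r (A v (ℓ + 1)) then y (p v) + 1 else y (p v) :=
    fun v hv hl => by rw [(hy v).1 ⟨_, hv⟩, if_neg (by omega)]
  have same : ∀ v, ∀ u, B u v → L u = L v → y v = y u + (r u - r v) := by
    refine h.parent_induction hp (fun v hv u hu => absurd hu (hv u)) ?_ ?_
    · intro v hv hl ih u hu hul
      rw [hsame v hv hl]
      rcases (hp.parent hu).2 with rfl | h2
      · rfl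
      · have h3 := hr (.single h2)
        have h4 := hr (.single hv)
        rw [ih u h2 (hul.trans hl.symm)]
        omega
    · intro v hv hl ih u hu hul
      rcases (hp.parent hu).2 with rfl | h2
      · omega
      · rcases hp.layer h2 with h3 | h3 <;> omega
  have light : ∀ v, ∀ u, B u v → L u + 1 = L v → r (A v 0) < r (A v (ℓ + 1)) → y u < y v := by
    refine h.parent_induction hp (fun v hv u hu => absurd hu (hv u)) ?_ ?_
    · intro v hv hl ih u hu hul hlt
      rw [hsame v hv hl]
      rcases (hp.parent hu).2 with rfl | h2
      · omega
      · have := ih u h2 (by omega) (by rwa [hA.same hv hl])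
        omega
    · intro v hv hl ih u hu hul hlt
      rw [hnext v hv hl, if_pos hlt]
      rcases (hp.parent hu).2 with rfl | h2
      · omega
      · have := same _ u h2 (by omega)
        omega
  refine ⟨y, fun u v => same v u, fun u v => light v u, fun v => ?_⟩
  suffices hb : ∀ v, y v + r v + ∑ j ∈ Finset.range (ℓ + 1), r (A v j) ≤ (ℓ + 2) * R by
    have := hb v; omega
  refine h.parent_induction hp ?_ ?_ ?_
  · intro v hv
    have h1 : ∑ j ∈ Finset.range (ℓ + 1), r (A v j) ≤ (ℓ + 1) * R := by
      simpa using Finset.sum_le_card_nsmul (Finset.range (ℓ + 1)) (fun j => r (A v j)) R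
        fun j _ => hR _
    rw [(hy v).2 fun ⟨u, hu⟩ => hv u hu]
    have := hR v
    linarith
  · intro v hv hl ih
    have h4 := hr (.single hv)
    rw [hsame v hv hl, ← hA.same hv hl]
    omega
  · intro v hv hl ih
    have h4 := hr (.single hv)
    rw [Finset.sum_range_succ, ← hA.next hv hl ℓ] at ih
    rw [Finset.sum_range_succ', Finset.sum_congr rfl fun j _ => by rw [hA.next hv hl j],
      hnext v hv hl]
    split_ifs with hlt
    · omega
    · have : r (A v (ℓ + 1)) ≥ r (A v 0) := by
        refine hr ?_
        have : ∀ j, Relation.ReflTransGen B (A v j) (A v 0) := fun j => by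
          induction j with
          | zero => exact .refl
          | succ j ih => exact (hA.anc_succ v j).trans ih
        exact this _
      omega

/-- Few ports of a layer lie below a common component `ℓ` layers higher: the components that make
them ports carry disjoint weights of the same rank as that common ancestor. -/
theorem IsElimination.ncard_port_le [Finite V] (h : IsElimination B ord t)
    (hp : IsLayering B p L) (hA : IsComponentRoot B L A) {w : V → ℕ} (hw : IsWeight B w) {D : ℕ}
    (hD : 1 < D) (ℓ i : ℕ) (g : V) :
    {u | IsPort B L A (fun v => Nat.log D (w v)) ℓ u ∧ (L u, A u ℓ) = (i, g)}.ncard ≤ t * D := by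
  classical
  have := Fintype.ofFinite V
  set r : V → ℕ := fun v => Nat.log D (w v) with hr
  let E : Finset V := {e | L e = i + 1 ∧ A e 0 = e ∧ A e (ℓ + 1) = g ∧ r g ≤ r e}
  have hE : E.card ≤ D := by
    have hsum : ∑ e ∈ E, w e ≤ w g := by
      refine hw.sum_le g E (fun e he => ?_) fun e he e' he' hee => ?_
      · have he := (Finset.mem_filter.1 he).2
        exact he.2.2.1 ▸ hA.anc e (ℓ + 1)
      · have he := (Finset.mem_filter.1 he).2
        have he' := (Finset.mem_filter.1 he').2
        rw [← he.2.1, ← he'.2.1, hp.root_eq_of_anc hA hee (he.1.trans he'.1.symm)]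
    have h1 : ∀ e ∈ E, D ^ r g ≤ w e := fun e he =>
      (Nat.pow_le_pow_right (by omega) (Finset.mem_filter.1 he).2.2.2.2).trans
        (Nat.pow_log_le_self D (Nat.one_le_iff_ne_zero.1 (hw.one_le e)))
    have h2 := Finset.card_nsmul_le_sum E w _ h1
    have h3 : w g < D ^ (r g + 1) := Nat.lt_pow_succ_log_self hD _
    have h4 : D ^ r g * E.card < D ^ r g * D := by
      rw [← pow_succ, mul_comm]; exact (h2.trans hsum).trans_lt h3
    exact (lt_of_mul_lt_mul_left h4 (Nat.zero_le _)).le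
  have hsub : {u | IsPort B L A r ℓ u ∧ (L u, A u ℓ) = (i, g)} ⊆
      ((E.biUnion fun e => {u | B u e} : Finset V) : Set V) := by
    rintro u ⟨⟨v, hb, hl, hrv⟩, hk⟩
    obtain ⟨hk1, hk2⟩ := Prod.mk.inj hk
    simp only [Finset.coe_biUnion, Set.mem_iUnion, Finset.mem_coe, Finset.mem_filter_univ]
    refine ⟨A v 0, ?_, hA.attach hb hl⟩
    simp only [E, Finset.mem_filter_univ]
    have h5 : A v (ℓ + 1) = g := by rw [hA.next hb hl, hk2]
    refine ⟨by rw [hA.layer_root, ← hl, hk1], by rw [hA.root], by rw [hA.root, h5], ?_⟩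
    rwa [h5] at hrv
  calc _ ≤ ((E.biUnion fun e => {u | B u e} : Finset V) : Set V).ncard :=
        Set.ncard_le_ncard hsub
    _ = _ := Set.ncard_coe_finset _
    _ ≤ E.card * t := Finset.card_biUnion_le_card_mul _ _ _ fun e _ => by
        rw [← Set.ncard_coe_finset]
        simpa using h.card_le e
    _ ≤ t * D := by rw [mul_comm]; exact Nat.mul_le_mul_left _ hE

end deficit

/-- If all classes of a partition have at most `N` elements, then `N` indices suffice to number
each class injectively. -/
theorem exists_index {V κ : Type*} [Finite V] (P : V → Prop) (key : V → κ) (N : ℕ)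
    (hN : ∀ k, {u | P u ∧ key u = k}.ncard ≤ N) :
    ∃ idx : V → ℕ, (∀ u, P u → idx u < N) ∧
      ∀ u v, P u → P v → key u = key v → idx u = idx v → u = v := by
  classical
  have : ∀ k, ∃ f : V → ℕ, (∀ u, P u ∧ key u = k → f u < N) ∧
      ∀ u v, (P u ∧ key u = k) → (P v ∧ key v = k) → f u = f v → u = v := by
    intro k
    set S : Finset V := (Set.toFinite {u | P u ∧ key u = k}).toFinset with hS
    have hc : S.card ≤ N := by
      rw [← Set.ncard_coe_finset]
      simpa [hS] using hN k
    have hm : ∀ u, (P u ∧ key u = k) → u ∈ S := fun u hu => by simpa [hS] using hu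
    refine ⟨fun u => if hu : u ∈ S then S.equivFin ⟨u, hu⟩ else 0, fun u hu => ?_,
      fun u v hu hv huv => ?_⟩
    · simp only [dif_pos (hm u hu)]
      exact (Fin.is_lt _).trans_le hc
    · simp only [dif_pos (hm u hu), dif_pos (hm v hv)] at huv
      simpa using S.equivFin.injective (Fin.ext huv)
  choose f hf1 hf2 using this
  refine ⟨fun u => f (key u) u, fun u hu => hf1 _ u ⟨hu, rfl⟩, fun u v hu hv hk huv => ?_⟩
  simp only [← hk] at huv
  exact hf2 _ u v ⟨hu, rfl⟩ ⟨hv, hk.symm⟩ huv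

/-! ### The colouring -/

/-- `k` colours suffice for a valley `ℓ`-ranking whenever there are at most `t` back neighbours
and some weight is at most `M`. -/
def ColorBound.{u} (ℓ t M k : ℕ) : Prop :=
  ∀ (V : Type u) [Finite V] (B : V → V → Prop) (ord w : V → ℕ), IsElimination B ord t →
    IsWeight B w → (∀ v, w v ≤ M) → ∃ φ : V → ℕ, (∀ v, φ v < k) ∧ IsValleyRanking B ℓ φ

theorem colorBound_zero.{u} (ℓ M : ℕ) : ColorBound.{u} ℓ 0 M 1 := by
  intro V _ B ord w h _ _
  have hB : ∀ u v, ¬ B u v := fun u v huv => by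
    have h1 := h.card_le v
    rw [Nat.le_zero, Set.ncard_eq_zero] at h1
    exact (h1 ▸ (huv : u ∈ {u | B u v}) : u ∈ (∅ : Set V))
  refine ⟨fun _ => 0, fun _ => one_pos, ?_⟩
  intro a u v i j _ _ hu hv
  cases hu with
  | single => cases hv with
    | single => rfl
    | snoc _ hb => exact absurd hb (hB _ _)
  | snoc _ hb => exact absurd hb (hB _ _)

theorem ColorBound.succ.{u} {ℓ t M D F : ℕ} (hD : 1 < D) (ih : ColorBound.{u} ℓ t D F) :
    ColorBound.{u} ℓ (t + 1) M
      ((ℓ + 1) * (((ℓ + 2) * Nat.log D M + 1) * F + (t + 1) * D)) := by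
  classical
  intro V _ B ord w h hw hM
  obtain ⟨p, L, hp⟩ := h.exists_layering
  obtain ⟨A, hA⟩ := h.exists_componentRoot hp
  set r : V → ℕ := fun v => Nat.log D (w v) with hr
  set Y := (ℓ + 2) * Nat.log D M with hY
  have hmono : ∀ {u v}, Relation.ReflTransGen B u v → r v ≤ r u := fun huv => hw.log_mono D huv
  obtain ⟨y, hy_same, hy_light, hyY⟩ := h.exists_deficit hp hA hmono
    (fun v => Nat.log_mono_right (hM v)) ℓ
  obtain ⟨idx, hidx, hinj⟩ := exists_index (IsPort B L A r ℓ) (fun u => (L u, A u ℓ)) ((t + 1) * D)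
    fun ⟨i, g⟩ => h.ncard_port_le hp hA hw hD ℓ i g
  obtain ⟨ψ, hψF, hψ⟩ := ih V (restrictClass B L r) ord _ (h.restrictClass hp r)
    (hw.restrictClass hp hD) fun v => by
      have h1 : w v < D ^ (r v + 1) := Nat.lt_pow_succ_log_self hD _
      rw [pow_succ] at h1
      exact (Nat.div_lt_of_lt_mul h1).le
  -- ports lie above everything else; the other colours are ordered by the deficit
  set m : V → ℕ := fun v =>
    if IsPort B L A r ℓ v then (Y + 1) * F + idx v else (Y - y v) * F + ψ v with hm
  have hm_port : ∀ v, IsPort B L A r ℓ v → m v = (Y + 1) * F + idx v := fun v hv => if_pos hv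
  have hm_low : ∀ v, ¬ IsPort B L A r ℓ v → m v = (Y - y v) * F + ψ v := fun v hv => if_neg hv
  have hlow_lt : ∀ v, ¬ IsPort B L A r ℓ v → m v < (Y - y v + 1) * F := fun v hv => by
    rw [hm_low v hv, add_one_mul]; have := hψF v; omega
  have hlow : ∀ v, ¬ IsPort B L A r ℓ v → m v < (Y + 1) * F := fun v hv =>
    (hlow_lt v hv).trans_le (Nat.mul_le_mul_right _ (by omega))
  -- a smaller deficit means a larger colour
  have hm_lt : ∀ u z, ¬ IsPort B L A r ℓ u → y z < y u → m u < m z := by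
    intro u z hu hz
    by_cases hzp : IsPort B L A r ℓ z
    · rw [hm_port z hzp]
      exact (hlow u hu).trans_le (Nat.le_add_right _ _)
    · rw [hm_low z hzp]
      refine (hlow_lt u hu).trans_le ((Nat.mul_le_mul_right F ?_).trans (Nat.le_add_right _ _))
      have := hyY u
      omega
  have hℓ : 0 < ℓ + 1 := ℓ.succ_pos
  have hdiv : ∀ v, (m v * (ℓ + 1) + L v % (ℓ + 1)) / (ℓ + 1) = m v := fun v => by
    rw [mul_comm, Nat.mul_add_div hℓ, Nat.div_eq_of_lt (Nat.mod_lt _ hℓ), add_zero]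
  have hmle : ∀ u x, m x * (ℓ + 1) + L x % (ℓ + 1) ≤ m u * (ℓ + 1) + L u % (ℓ + 1) → m x ≤ m u :=
    fun u x hx => by have := Nat.div_le_div_right (c := ℓ + 1) hx; rwa [hdiv, hdiv] at this
  refine ⟨fun v => m v * (ℓ + 1) + L v % (ℓ + 1), fun v => ?_, ?_⟩
  · have h1 : m v < (Y + 1) * F + (t + 1) * D := by
      by_cases hv : IsPort B L A r ℓ v
      · rw [hm_port v hv]; have := hidx v hv; omega
      · have := hlow v hv; omega
    have h2 := Nat.mod_lt (L v) hℓ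
    calc m v * (ℓ + 1) + L v % (ℓ + 1) < (m v + 1) * (ℓ + 1) := by rw [add_one_mul]; omega
      _ ≤ _ := by rw [mul_comm]; exact Nat.mul_le_mul_left _ h1
  -- a chain ending at a vertex that is not a port, with no larger colours, stays in its class
  have hchain : ∀ (u : V), ¬ IsPort B L A r ℓ u → ∀ {k : ℕ} {a x : V},
      Chain B (fun z => m z ≤ m u) k a x → L x = L u → r x = r u → y x = y u →
      Chain (restrictClass B L r) (fun z => ψ z ≤ ψ u) k a x := by
    intro u hu k a x hc
    have hψle : ∀ x, m x ≤ m u → y x = y u → ψ x ≤ ψ u := fun x hx hyx => by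
      have hxp : ¬ IsPort B L A r ℓ x := fun hxp => by
        have h1 := hlow u hu
        rw [hm_port x hxp] at hx
        omega
      rw [hm_low x hxp, hm_low u hu, hyx] at hx
      omega
    induction hc with
    | single ha => intro _ _ hyx; exact .single (hψle _ ha hyx)
    | @snoc k a z x hz hb hx ih =>
      intro hLx hrx hyx
      have hzm := hz.mem_bot
      have hzy : y u ≤ y z := not_lt.1 fun hlt => (hm_lt u z hu hlt).not_ge hzm
      have hzr := hmono (.single hb)
      rcases hp.layer hb with hl | hl
      · have h1 := hy_same z x hb hl
        exact .snoc (ih (by omega) (by omega) (by omega)) ⟨hb, hl, by omega⟩ (hψle x hx hyx)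
      · by_cases hlt : r (A x 0) < r (A x (ℓ + 1))
        · have := hy_light z x hb hl hlt
          omega
        · exfalso
          have h1 := hlow u hu
          rw [hm_port z ⟨x, hb, hl, not_lt.1 hlt⟩] at hzm
          omega
  intro a u v i j hij huv hau hav
  beta_reduce at huv
  have hmuv : m u = m v := by rw [← hdiv u, ← hdiv v, huv]
  have hau' : Chain B (fun z => m z ≤ m u) i a u := hau.imp (hmle u)
  have hav' : Chain B (fun z => m z ≤ m u) j a v := hav.imp (hmle u)
  obtain ⟨d, hd, hLu, hAu⟩ := hp.root_of_chain hA hau'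
  obtain ⟨e, he, hLv, hAv⟩ := hp.root_of_chain hA hav'
  -- the layers of `u` and `v` agree modulo `ℓ + 1` and differ by at most `ℓ`
  have hde : d = e := by
    have h1 : L u % (ℓ + 1) = L v % (ℓ + 1) := by
      rw [hmuv] at huv; exact Nat.add_left_cancel huv
    have h2 : L a + d ≡ L a + e [MOD ℓ + 1] := by rw [← hLu, ← hLv]; exact h1
    have h3 := Nat.ModEq.add_left_cancel' _ h2
    exact Nat.ModEq.eq_of_lt_of_lt h3 (by omega) (by omega)
  subst hde
  have hL : L u = L v := hLu.trans hLv.symm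
  -- ports with the same component root `ℓ` layers higher have distinct indices
  by_cases hu : IsPort B L A r ℓ u
  · have hv : IsPort B L A r ℓ v := by
      by_contra hv
      have := hlow v hv
      rw [← hmuv, hm_port u hu] at this
      omega
    have hk : A u ℓ = A v ℓ := by
      have h1 := hAu (ℓ - d)
      have h2 := hAv (ℓ - d)
      rw [Nat.add_sub_cancel' (by omega)] at h1 h2
      rw [h1, h2]
    refine hinj u v hu hv (by simp only [hL, hk]) ?_
    rw [hm_port u hu, hm_port v hv] at hmuv
    omega
  · have hv : ¬ IsPort B L A r ℓ v := fun hv => by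
      have := hlow u hu
      rw [hmuv, hm_port v hv] at this
      omega
    have hyy : y v = y u := by
      rcases lt_trichotomy (y v) (y u) with hlt | heq | hlt
      · exact absurd hmuv (hm_lt u v hu hlt).ne
      · exact heq
      · exact absurd hmuv (hm_lt v u hv hlt).ne'
    have hψuv : ψ u = ψ v := by
      rw [hm_low u hu, hm_low v hv, hyy] at hmuv
      omega
    have hcu := hchain u hu hau' rfl rfl rfl
    have hcv := hchain v hv (hmuv ▸ hav') rfl rfl rfl
    rw [← hψuv] at hcv
    exact hψ a u v i j hij hψuv hcu hcv

/-! ### Treewidth and elimination orders -/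

namespace SimpleGraph

/-- In a tree, orient edges away from `ρ`: this is an elimination order of back degree one. -/
theorem IsTree.isElimination {N : Type*} [Finite N] {T : SimpleGraph N} (hT : T.IsTree) (ρ : N) :
    IsElimination (fun x y => T.Adj x y ∧ T.dist ρ x < T.dist ρ y) (T.dist ρ) 1 := by
  have huniq : ∀ u v w, (T.Adj u w ∧ T.dist ρ u < T.dist ρ w) →
      (T.Adj v w ∧ T.dist ρ v < T.dist ρ w) → u = v := by
    rintro u v w ⟨hu, hu'⟩ ⟨hv, hv'⟩
    have key : ∀ u, T.Adj u w → T.dist ρ u < T.dist ρ w → ∃ p : T.Walk ρ w, p.IsPath ∧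
        p.penultimate = u := by
      intro u hu hlt
      obtain ⟨p, hp⟩ := hT.connected.exists_walk_length_eq_dist ρ u
      refine ⟨p.concat hu, Walk.isPath_of_length_eq_dist _ ?_, by simp⟩
      rw [Walk.length_concat, hp]
      rcases hT.dist_eq_dist_add_one_of_adj ρ hu with h | h <;> omega
    obtain ⟨p, hp, rfl⟩ := key u hu hu'
    obtain ⟨q, hq, rfl⟩ := key v hv hv'
    rw [(hT.existsUnique_path ρ w).unique hp hq]
  refine ⟨fun h => h.2, fun hu hv => .inl (huniq _ _ _ hu hv), fun v => ?_⟩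
  rw [Set.ncard_le_one]
  exact fun a ha b hb => huniq a b v ha hb

/-- Two subtrees with a common node: the one with the lower top node has this node in the other. -/
theorem IsTree.top_mem {N : Type*} [Finite N] {T : SimpleGraph N} (hT : T.IsTree) (ρ : N)
    {S S' : Set N} (hS : (T.induce S).Connected) (hS' : (T.induce S').Connected) {a a' x : N}
    (ha : a ∈ S) (ha' : a' ∈ S') (hmin : ∀ z ∈ S, T.dist ρ a ≤ T.dist ρ z)
    (hmin' : ∀ z ∈ S', T.dist ρ a' ≤ T.dist ρ z) (hx : x ∈ S) (hx' : x ∈ S')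
    (hle : T.dist ρ a ≤ T.dist ρ a') : a' ∈ S := by
  have hE := hT.isElimination ρ
  have key : ∀ (S : Set N), (T.induce S).Connected → ∀ a ∈ S, (∀ z ∈ S, T.dist ρ a ≤ T.dist ρ z) →
      x ∈ S → ∃ k, Chain (fun x y => T.Adj x y ∧ T.dist ρ x < T.dist ρ y) (· ∈ S) k a x := by
    intro S hS a ha hmin hx
    obtain ⟨p⟩ := hS.preconnected ⟨x, hx⟩ ⟨a, ha⟩
    obtain ⟨b, i, j, -, hbx, hba⟩ := hE.exists_valley (G := T)
      (fun u v huv => by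
        rcases hT.dist_eq_dist_add_one_of_adj ρ huv with h | h
        · exact .inr ⟨huv.symm, by omega⟩
        · exact .inl ⟨huv, by omega⟩) (A := (· ∈ S)) (p.map (Embedding.induce S).toHom)
      (by
        intro y hy
        rw [Walk.support_map, List.mem_map] at hy
        obtain ⟨z, -, rfl⟩ := hy
        exact z.2)
    have hb := hmin b hba.mem_top
    cases hba with
    | single => exact ⟨i, hbx⟩
    | snoc hbv hva _ =>
      have h1 := hva.2
      have h2 := hE.ord_le hbv.reflTransGen
      exact absurd (hb.trans h2) (not_le.2 h1)
  obtain ⟨k, hk⟩ := key S hS a ha hmin hx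
  obtain ⟨k', hk'⟩ := key S' hS' a' ha' hmin' hx'
  clear hx hx' key
  induction hk generalizing k' with
  | single ha =>
    cases hk' with
    | single => exact ha
    | snoc h1 h2 _ =>
      have h3 := h2.2
      have h4 := hE.ord_le h1.reflTransGen
      omega
  | snoc h1 h2 h3 ih =>
    cases hk' with
    | single => exact h3
    | snoc h1' h2' _ =>
      rcases hE.clique h2 h2' with rfl | h4 | h4
      · exact ih ha hmin hle _ h1'
      · have := hT.dist_eq_dist_add_one_of_adj ρ h2.1
        have := hT.dist_eq_dist_add_one_of_adj ρ h2'.1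
        have := h4.2
        have := h2.2
        have := h2'.2
        omega
      · have := hT.dist_eq_dist_add_one_of_adj ρ h2.1
        have := hT.dist_eq_dist_add_one_of_adj ρ h2'.1
        have := h4.2
        have := h2.2
        have := h2'.2
        omega

/-- Root the decomposition tree; a vertex precedes another if its highest bag is nearer to the
root. The back neighbours of `v` then lie in the highest bag of `v`. -/
theorem TreeDecomposition.exists_isElimination {V : Type*} [Fintype V] {G : SimpleGraph V}
    (D : G.TreeDecomposition) {t : ℕ} (ht : D.width ≤ t) :
    ∃ (B : V → V → Prop) (ord : V → ℕ), IsElimination B ord t ∧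
      ∀ u v, G.Adj u v → B u v ∨ B v u := by
  classical
  have hT := D.isTree
  obtain ⟨ρ⟩ := hT.connected.nonempty
  have htop : ∀ v, ∃ a, v ∈ D.bag a ∧ ∀ z, v ∈ D.bag z → D.tree.dist ρ a ≤ D.tree.dist ρ z := by
    intro v
    obtain ⟨x, hx⟩ := (D.connected_induce v).nonempty
    obtain ⟨a, ha, hmin⟩ := Set.exists_min_image {x | v ∈ D.bag x} (D.tree.dist ρ)
      (Set.toFinite _) ⟨x, hx⟩
    exact ⟨a, ha, hmin⟩
  choose τ hτ hmin using htop
  set e := Fintype.equivFin V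
  let ord : V → ℕ := fun v => D.tree.dist ρ (τ v) * Fintype.card V + e v
  have hord : ∀ u v, ord u < ord v → D.tree.dist ρ (τ u) ≤ D.tree.dist ρ (τ v) := by
    intro u v huv
    by_contra! hlt
    have h1 : (D.tree.dist ρ (τ v) + 1) * Fintype.card V ≤ D.tree.dist ρ (τ u) * Fintype.card V :=
      Nat.mul_le_mul_right _ hlt
    have h2 := (e v).is_lt
    rw [add_one_mul] at h1
    simp only [ord] at huv
    omega
  have hinj : ∀ u v, u ≠ v → ord u < ord v ∨ ord v < ord u := by
    intro u v huv
    rcases lt_trichotomy (ord u) (ord v) with h | h | h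
    · exact .inl h
    · exfalso
      have h1 : ∀ v, ord v % Fintype.card V = e v := fun v => by
        simp only [ord, mul_comm _ (Fintype.card V), Nat.mul_add_mod,
          Nat.mod_eq_of_lt (e v).is_lt]
      have h2 := h1 u
      rw [h, h1 v] at h2
      exact huv (e.injective (Fin.ext h2.symm))
    · exact .inr h
  have hmem : ∀ u v, ord u < ord v → (∃ x, u ∈ D.bag x ∧ v ∈ D.bag x) → u ∈ D.bag (τ v) := by
    rintro u v huv ⟨x, hu, hv⟩
    exact hT.top_mem ρ (D.connected_induce u) (D.connected_induce v) (hτ u) (hτ v) (hmin u)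
      (hmin v) hu hv (hord u v huv)
  refine ⟨fun u v => ord u < ord v ∧ ∃ x, u ∈ D.bag x ∧ v ∈ D.bag x, ord, ⟨fun h => h.1, ?_, ?_⟩,
    fun u v huv => ?_⟩
  · rintro u v w ⟨hu, hux⟩ ⟨hv, hvx⟩
    by_cases huv : u = v
    · exact .inl huv
    have hu' := hmem u w hu hux
    have hv' := hmem v w hv hvx
    rcases hinj u v huv with h | h
    · exact .inr (.inl ⟨h, _, hu', hv'⟩)
    · exact .inr (.inr ⟨h, _, hv', hu'⟩)
  · intro v
    have hcard : (D.bag (τ v)).card ≤ t + 1 := by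
      have h1 : (D.bag (τ v)).card ≤ Finset.univ.sup fun x => (D.bag x).card :=
        Finset.le_sup (f := fun x => (D.bag x).card) (Finset.mem_univ (τ v))
      unfold TreeDecomposition.width at ht
      omega
    have hsub : {u | ord u < ord v ∧ ∃ x, u ∈ D.bag x ∧ v ∈ D.bag x} ⊆
        (((D.bag (τ v)).erase v : Finset V) : Set V) := by
      rintro u ⟨hu, hux⟩
      rw [Finset.mem_coe, Finset.mem_erase]
      exact ⟨fun h => by subst h; exact hu.false, hmem u v hu hux⟩
    have h2 := Set.ncard_le_ncard hsub
    rw [Set.ncard_coe_finset, Finset.card_erase_of_mem (hτ v)] at h2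
    omega
  · obtain ⟨x, hx⟩ := D.exists_bag_of_adj u v huv
    rcases hinj u v huv.ne with h | h
    · exact .inl ⟨h, x, hx⟩
    · exact .inr ⟨h, x, hx.symm⟩

theorem TreeDecomposition.neg_one_le_width {V : Type*} {G : SimpleGraph V}
    (D : G.TreeDecomposition) : -1 ≤ D.width := by
  unfold TreeDecomposition.width
  omega

theorem bddBelow_width {V : Type*} (G : SimpleGraph V) :
    BddBelow {w : ℤ | ∃ D : G.TreeDecomposition, D.width = w} :=
  ⟨-1, by rintro _ ⟨D, rfl⟩; exact D.neg_one_le_width⟩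

theorem exists_treeDecomposition_width_eq {V : Type*} [Fintype V] (G : SimpleGraph V) :
    ∃ D : G.TreeDecomposition, D.width = G.treewidth := by
  refine Int.csInf_mem (s := {w : ℤ | ∃ D : G.TreeDecomposition, D.width = w}) ?_ (bddBelow_width G)
  let D : G.TreeDecomposition :=
    { Node := Unit
      tree := ⊥
      isTree := IsTree.of_subsingleton
      bag := fun _ => Finset.univ
      connected_induce := fun v => by
        have : Nonempty {x : Unit | v ∈ (Finset.univ : Finset V)} := ⟨⟨(), by simp⟩⟩
        exact IsTree.of_subsingleton.connected
      exists_bag_of_adj := fun v w _ => ⟨(), by simp, by simp⟩ }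
  exact ⟨D.width, D, rfl⟩

theorem exists_isElimination_of_treewidth_le {V : Type*} [Fintype V] {G : SimpleGraph V} {t : ℕ}
    (ht : G.treewidth ≤ t) :
    ∃ (B : V → V → Prop) (ord : V → ℕ), IsElimination B ord t ∧
      ∀ u v, G.Adj u v → B u v ∨ B v u := by
  obtain ⟨D, hD⟩ := G.exists_treeDecomposition_width_eq
  exact D.exists_isElimination (hD.trans_le ht)

theorem treewidth_nonneg {V : Type*} [Fintype V] [Nonempty V] (G : SimpleGraph V) :
    0 ≤ G.treewidth := by
  obtain ⟨D, hD⟩ := G.exists_treeDecomposition_width_eq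
  obtain ⟨v⟩ := ‹Nonempty V›
  obtain ⟨x, hx⟩ := (D.connected_induce v).nonempty
  have h1 : (D.bag x).card ≤ Finset.univ.sup fun x => (D.bag x).card :=
    Finset.le_sup (f := fun x => (D.bag x).card) (Finset.mem_univ x)
  have h2 : 0 < (D.bag x).card := Finset.card_pos.2 ⟨v, hx⟩
  rw [← hD]
  unfold TreeDecomposition.width
  omega

end SimpleGraph

open SimpleGraph in
/-- The decomposition tree is the elimination forest, its trees joined at a common root `ρ`; the
bag of `v` consists of `v` and its back neighbours. -/
theorem IsElimination.treewidth_le {V : Type} [Fintype V] [Nonempty V] {B : V → V → Prop}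
    {ord : V → ℕ} {t : ℕ} (h : IsElimination B ord t) {G : SimpleGraph V}
    (hG : ∀ u v, G.Adj u v → B u v ∨ B v u) : G.treewidth ≤ t := by
  classical
  obtain ⟨p, hp⟩ := h.exists_parent
  obtain ⟨ρ, hρ⟩ := Finite.exists_min ord
  have hρB : ∀ u, ¬ B u ρ := fun u hu => (hρ u).not_gt (h.ord_lt hu)
  let q : V → V := fun v => if ∃ u, B u v then p v else ρ
  have hq : ∀ u v, B u v → q v = p v := fun u v hu => if_pos ⟨u, hu⟩
  let T : SimpleGraph V := SimpleGraph.fromRel fun u v => u = q v ∧ v ≠ ρ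
  have hqord : ∀ v, v ≠ ρ → q v = ρ ∨ ord (q v) < ord v := by
    intro v hv
    by_cases hb : ∃ u, B u v
    · obtain ⟨u, hu⟩ := hb
      rw [hq u v hu]
      exact .inr (h.ord_lt (hp u v hu).1)
    · exact .inl (if_neg hb)
  have hqne : ∀ v, v ≠ ρ → q v ≠ v := fun v hv heq => by
    rcases hqord v hv with h1 | h1
    · exact hv (heq.symm.trans h1)
    · rw [heq] at h1; exact h1.false
  have hqT : ∀ v, v ≠ ρ → T.Adj (q v) v := fun v hv =>
    (SimpleGraph.fromRel_adj _ _ _).2 ⟨hqne v hv, .inl ⟨rfl, hv⟩⟩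
  have hreach : ∀ n v, ord v ≤ n → T.Reachable ρ v := by
    intro n
    induction n with
    | zero =>
      intro v hv
      by_cases hv' : v = ρ
      · rw [hv']
      rcases hqord v hv' with h1 | h1
      · exact (h1 ▸ hqT v hv').reachable
      · omega
    | succ n ih =>
      intro v hv
      by_cases hv' : v = ρ
      · rw [hv']
      rcases hqord v hv' with h1 | h1
      · exact (h1 ▸ hqT v hv').reachable
      · exact (ih (q v) (by omega)).trans (hqT v hv').reachable
  have hconn : T.Connected :=
    ⟨fun u v => (hreach _ u le_rfl).symm.trans (hreach _ v le_rfl)⟩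
  have hT : T.IsTree := by
    rw [isTree_iff_connected_and_card]
    refine ⟨hconn, le_antisymm ?_ hconn.card_vert_le_card_edgeSet_add_one⟩
    have hsub : T.edgeSet ⊆ (fun v => s(q v, v)) '' {ρ}ᶜ := by
      intro e
      induction e with
      | h x y =>
        intro hxy
        rw [SimpleGraph.mem_edgeSet, SimpleGraph.fromRel_adj] at hxy
        rcases hxy.2 with ⟨rfl, hy⟩ | ⟨rfl, hx⟩
        · exact ⟨y, hy, rfl⟩
        · exact ⟨x, hx, Sym2.eq_swap⟩
    have h1 := (Set.ncard_le_ncard hsub (Set.toFinite _)).trans (Set.ncard_image_le (Set.toFinite _))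
    have h2 := Set.ncard_add_ncard_compl ({ρ} : Set V)
    rw [Set.ncard_singleton] at h2
    rw [Nat.card_coe_set_eq]
    omega
  let bag : V → Finset V := fun v => insert v ({u | B u v} : Finset V)
  have hbag : ∀ u v, u ∈ bag v ↔ u = v ∨ B u v := fun u v => by
    simp [bag]
  let D : G.TreeDecomposition :=
    { Node := V
      tree := T
      isTree := hT
      bag := bag
      connected_induce := by
        intro v
        have hv : v ∈ {x | v ∈ bag x} := (hbag v v).2 (.inl rfl)
        have key : ∀ n x, ord x ≤ n → ∀ hx : x ∈ {x | v ∈ bag x},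
            (T.induce {x | v ∈ bag x}).Reachable ⟨v, hv⟩ ⟨x, hx⟩ := by
          intro n
          induction n with
          | zero =>
            intro x hxn hx
            rcases (hbag v x).1 hx with rfl | hb
            · exact .refl _
            · have := h.ord_lt hb; omega
          | succ n ih =>
            intro x hxn hx
            rcases (hbag v x).1 hx with rfl | hb
            · exact .refl _
            · have h1 := hp v x hb
              have h2 := h.ord_lt h1.1
              have hpx : p x ∈ {x | v ∈ bag x} := (hbag v (p x)).2 h1.2
              refine (ih (p x) (by omega) hpx).trans (SimpleGraph.Adj.reachable ?_)
              have h3 := hqT x fun hxρ => hρB v (hxρ ▸ hb)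
              rw [hq v x hb] at h3
              exact h3
        have : Nonempty {x | v ∈ bag x} := ⟨⟨v, hv⟩⟩
        exact ⟨fun x y => (key _ x le_rfl x.2).symm.trans (key _ y le_rfl y.2)⟩
      exists_bag_of_adj := fun v w hvw => by
        rcases hG v w hvw with hb | hb
        · exact ⟨w, (hbag v w).2 (.inr hb), (hbag w w).2 (.inl rfl)⟩
        · exact ⟨v, (hbag v v).2 (.inl rfl), (hbag w v).2 (.inr hb)⟩ }
  have hw : D.width ≤ t := by
    have h1 : (Finset.univ.sup fun x => (D.bag x).card) ≤ t + 1 := by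
      refine Finset.sup_le fun v _ => (Finset.card_insert_le _ _).trans ?_
      have h2 := h.card_le v
      rw [Set.ncard_eq_toFinset_card'] at h2
      simpa using h2
    unfold TreeDecomposition.width
    omega
  exact (csInf_le (bddBelow_width G) ⟨D, rfl⟩).trans hw

/-! ### Ranking numbers -/

namespace SimpleGraph

theorem IsRanking.comp_hom {V W : Type*} {G : SimpleGraph V} {H : SimpleGraph W} {ℓ : ℕ}
    {φ : W → ℕ} (hφ : H.IsRanking ℓ φ) (f : G →g H) (hf : Function.Injective f) :
    G.IsRanking ℓ (φ ∘ f) := by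
  intro u v p hp h1 hl
  rcases hφ _ _ (p.map f) (hp.map hf) (by simpa) (by simpa) with h | h
  · exact .inl h
  · obtain ⟨w, hw, hlt⟩ := h
    rw [Walk.support_map, List.mem_map] at hw
    obtain ⟨z, hz, rfl⟩ := hw
    exact .inr ⟨z, hz, hlt⟩

theorem IsRanking.strictMonoOn_comp {V : Type*} {G : SimpleGraph V} {ℓ : ℕ} {φ : V → ℕ}
    (hφ : G.IsRanking ℓ φ) {f : ℕ → ℕ} {s : Set ℕ} (hf : StrictMonoOn f s) (hs : ∀ v, φ v ∈ s) :
    G.IsRanking ℓ (f ∘ φ) := by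
  intro u v p hp h1 hl
  rcases hφ u v p hp h1 hl with h | ⟨w, hw, hlt⟩
  · exact .inl fun he => h (hf.injOn (hs u) (hs v) he)
  · exact .inr ⟨w, hw, hf (hs u) (hs w) hlt⟩

theorem rankingNumber_le {V : Type*} {G : SimpleGraph V} {ℓ k : ℕ} {φ : V → ℕ}
    (hφ : G.IsRanking ℓ φ) (hk : ∀ v, φ v < k) : G.rankingNumber ℓ ≤ k :=
  Nat.sInf_le ⟨(· + 1) ∘ φ, fun v => Finset.mem_Icc.2 ⟨Nat.le_add_left _ _, hk v⟩,
    hφ.strictMonoOn_comp (s := Set.univ) (fun _ _ _ _ h => Nat.add_lt_add_right h 1)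
      fun _ => trivial⟩

theorem exists_isRanking_rankingNumber {V : Type*} [Fintype V] (G : SimpleGraph V) (ℓ : ℕ) :
    ∃ φ : V → ℕ, (∀ v, φ v < G.rankingNumber ℓ) ∧ G.IsRanking ℓ φ := by
  obtain ⟨φ, hφ, hr⟩ := Nat.sInf_mem
    (s := {k : ℕ | ∃ φ : V → ℕ, (∀ v, φ v ∈ Finset.Icc 1 k) ∧ G.IsRanking ℓ φ})
    ⟨Fintype.card V, fun v => Fintype.equivFin V v + 1, fun v => by simp, fun u v p hp h1 _ => by
      left
      intro huv
      obtain rfl : u = v := (Fintype.equivFin V).injective (Fin.ext (by simpa using huv))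
      rw [Walk.isPath_iff_nil, ← Walk.length_eq_zero_iff] at hp
      omega⟩
  refine ⟨(· - 1) ∘ φ, fun v => ?_, hr.strictMonoOn_comp (s := Set.Ici 1) ?_ fun v => ?_⟩
  · have := Finset.mem_Icc.1 (hφ v)
    simp only [Function.comp, rankingNumber]
    omega
  · intro a ha b _ hab
    have : 1 ≤ a := ha
    simp only
    omega
  · exact (Finset.mem_Icc.1 (hφ v)).1

end SimpleGraph

/-! ### Graphs with large ranking number -/

/-- Some graph with at most `N` vertices and at most `t` back neighbours per vertex needs at least
`h` colours in every `2`-ranking. -/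
def ExistsHardGraph (t N h : ℕ) : Prop :=
  ∃ (V : Type) (_ : Fintype V) (B : V → V → Prop) (ord : V → ℕ), Fintype.card V ≤ N ∧
    IsElimination B ord t ∧ ∀ (k : ℕ) (φ : V → ℕ), (∀ v, φ v < k) →
      (SimpleGraph.fromRel B).IsRanking 2 φ → h ≤ k

theorem existsHardGraph_zero {N : ℕ} (hN : 1 ≤ N) : ExistsHardGraph 0 N 1 :=
  ⟨Unit, inferInstance, fun _ _ => False, fun _ => 0, by simpa,
    ⟨fun h => h.elim, fun h => h.elim, fun v => by simp⟩,
    fun k φ hk _ => (Nat.zero_le _).trans_lt (hk ())⟩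

/-- The vertices are words over `Fin d × V`. Below the word `l` hang `d` copies of `V`, the `i`-th
one formed by the words `(i, a) :: l`; all of them are joined to `l`. -/
def wordRel {V : Type*} {d : ℕ} (B : V → V → Prop) (l m : List (Fin d × V)) : Prop :=
  ∃ i a l', m = (i, a) :: l' ∧ (l = l' ∨ ∃ b, B b a ∧ l = (i, b) :: l')

theorem wordRel_cons {V : Type*} {d : ℕ} {B : V → V → Prop} (i : Fin d) (a : V)
    (l : List (Fin d × V)) : wordRel B l ((i, a) :: l) :=
  ⟨i, a, l, rfl, .inl rfl⟩

theorem IsElimination.wordRel {V : Type*} [Finite V] {B : V → V → Prop} {ord : V → ℕ} {t : ℕ}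
    (h : IsElimination B ord t) (d s : ℕ) :
    IsElimination (fun l m : {l : List (Fin d × V) // l.length ≤ s} => wordRel B l.1 m.1)
      (fun l => (l.1.map fun x => ord x.2 + 1).sum) (t + 1) := by
  refine ⟨?_, ?_, ?_⟩
  · rintro ⟨l, hl⟩ ⟨m, hm⟩ ⟨i, a, l', rfl, h1 | ⟨b, hb, h1⟩⟩
    · simp only at h1; subst h1
      simp
    · simp only at h1; subst h1
      have := h.ord_lt hb
      simp
      omega
  · rintro ⟨u, hu⟩ ⟨v, hv⟩ ⟨w, hw⟩ ⟨i, a, l', h0, h1⟩ ⟨i', a', l'', h0', h2⟩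
    simp only at h0 h0' h1 h2
    subst h0
    obtain ⟨h3, rfl⟩ := List.cons.inj h0'
    obtain ⟨rfl, rfl⟩ := Prod.mk.inj h3
    rcases h1 with rfl | ⟨b, hb, rfl⟩ <;> rcases h2 with rfl | ⟨c, hc, rfl⟩
    · exact .inl rfl
    · exact .inr (.inl (wordRel_cons _ _ _))
    · exact .inr (.inr (wordRel_cons _ _ _))
    · rcases h.clique hb hc with rfl | h4 | h4
      · exact .inl rfl
      · exact .inr (.inl ⟨i, c, l', rfl, .inr ⟨b, h4, rfl⟩⟩)
      · exact .inr (.inr ⟨i, b, l', rfl, .inr ⟨c, h4, rfl⟩⟩)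
  · rintro ⟨m, hm⟩
    rw [← Set.ncard_image_of_injective _ Subtype.val_injective]
    cases m with
    | nil =>
      have : (Subtype.val '' {u : {l : List (Fin d × V) // l.length ≤ s} | _root_.wordRel B u.1 []})
          = ∅ := by
        refine Set.eq_empty_of_forall_notMem ?_
        rintro _ ⟨u, ⟨i, a, l', h0, -⟩, rfl⟩
        simp at h0
      simp [this]
    | cons x l =>
      obtain ⟨i, a⟩ := x
      have hsub : (Subtype.val '' {u : {l : List (Fin d × V) // l.length ≤ s} |
          _root_.wordRel B u.1 ((i, a) :: l)}) ⊆ insert l ((fun b => (i, b) :: l) '' {b | B b a}) := by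
        rintro _ ⟨u, ⟨i', a', l', h0, h1⟩, rfl⟩
        obtain ⟨h3, rfl⟩ := List.cons.inj h0
        obtain ⟨rfl, rfl⟩ := Prod.mk.inj h3
        rcases h1 with h1 | ⟨b, hb, h1⟩
        · exact .inl h1
        · exact .inr ⟨b, hb, h1.symm⟩
      have hfin : ((fun b => (i, b) :: l) '' {b | B b a}).Finite := Set.toFinite _
      calc _ ≤ _ := Set.ncard_le_ncard hsub (hfin.insert _)
        _ ≤ _ := Set.ncard_insert_le _ _
        _ ≤ t + 1 := Nat.add_le_add_right
          ((Set.ncard_image_le (Set.toFinite _)).trans (h.card_le a)) 1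

theorem card_words_le {α : Type*} [Fintype α] (s : ℕ) [Fintype {l : List α // l.length ≤ s}] :
    Fintype.card {l : List α // l.length ≤ s} ≤ (Fintype.card α + 1) ^ s := by
  have hinj : Function.Injective
      fun (l : {l : List α // l.length ≤ s}) (i : Fin s) => l.1[(i : ℕ)]? := by
    rintro ⟨l, hl⟩ ⟨m, hm⟩ hlm
    refine Subtype.ext (List.ext_getElem? fun n => ?_)
    by_cases hn : n < s
    · exact congrFun hlm ⟨n, hn⟩
    · simp only
      rw [List.getElem?_eq_none (by omega), List.getElem?_eq_none (by omega)]
  have := Fintype.card_le_of_injective _ hinj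
  simpa using this

/-- Two copies below `l` cannot share a colour that is at least the colour of `l`. As there are more
copies than colours, some copy has all its colours below that of `l`, and they span at least `h`
values. -/
theorem ExistsHardGraph.succ {t N h : ℕ} (hG : ExistsHardGraph t N h) (s : ℕ) :
    ExistsHardGraph (t + 1) (((h * s + 1) * N + 1) ^ s) (h * s + 1) := by
  obtain ⟨V, _, B, ord, hN, hB, hV⟩ := hG
  set d := h * s + 1 with hd
  have : Finite {l : List (Fin d × V) // l.length ≤ s} := List.finite_length_le _ s
  refine ⟨{l : List (Fin d × V) // l.length ≤ s}, Fintype.ofFinite _, _, _, ?_, hB.wordRel d s, ?_⟩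
  · refine (@card_words_le _ _ s (Fintype.ofFinite _)).trans (Nat.pow_le_pow_left ?_ s)
    rw [Fintype.card_prod, Fintype.card_fin]
    exact Nat.add_le_add_right (Nat.mul_le_mul_left _ hN) 1
  intro k φ hφk hφ
  by_contra! hk
  set G := SimpleGraph.fromRel
    fun l m : {l : List (Fin d × V) // l.length ≤ s} => wordRel B l.1 m.1 with hGdef
  have key : ∀ j (l : List (Fin d × V)) (hl : l.length + j ≤ s), h * j ≤ φ ⟨l, by omega⟩ := by
    intro j
    induction j with
    | zero => intro l hl; omega
    | succ j ih =>
      intro l hl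
      let c : Fin d → V → {l : List (Fin d × V) // l.length ≤ s} :=
        fun i a => ⟨(i, a) :: l, by simp; omega⟩
      let l₀ : {l : List (Fin d × V) // l.length ≤ s} := ⟨l, by omega⟩
      have hadj : ∀ i a, G.Adj l₀ (c i a) := fun i a =>
        (SimpleGraph.fromRel_adj _ _ _).2 ⟨fun he => by
          have := congrArg (fun z => z.1.length) he
          simp [l₀, c] at this, .inl (wordRel_cons i a l)⟩
      obtain ⟨i, hi⟩ : ∃ i, ∀ a, φ (c i a) < φ l₀ := by
        by_contra! hno
        choose a ha using hno
        obtain ⟨i, i', hne, heq⟩ := Fintype.exists_ne_map_eq_of_card_lt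
          (fun i => (⟨φ (c i (a i)), hφk _⟩ : Fin k)) (by simpa using hk)
        have heq : φ (c i (a i)) = φ (c i' (a i')) := congrArg Fin.val heq
        have hcne : c i (a i) ≠ c i' (a i') := fun he => hne (by
          have := congrArg (fun z => z.1.head?) he
          simp [c] at this
          exact this.1)
        let p : G.Walk (c i (a i)) (c i' (a i')) :=
          .cons (hadj i (a i)).symm (.cons (hadj i' (a i')) .nil)
        have hp : p.IsPath := by
          simp [p, SimpleGraph.Walk.cons_isPath_iff, hcne, (hadj i (a i)).ne',
            (hadj i' (a i')).ne]
        rcases hφ _ _ p hp (by simp [p]) (by simp [p]) with h1 | ⟨w, hw, hlt⟩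
        · exact h1 heq
        · simp only [p, SimpleGraph.Walk.support_cons, SimpleGraph.Walk.support_nil,
            List.mem_cons, List.not_mem_nil, or_false] at hw
          have := ha i
          rcases hw with rfl | rfl | rfl <;> omega
      have hlow : ∀ a, h * j ≤ φ (c i a) := fun a => ih ((i, a) :: l) (by simp; omega)
      have hl₀ : h * j ≤ φ l₀ := ih l (by omega)
      let f : SimpleGraph.fromRel B →g G :=
        { toFun := c i
          map_rel' := by
            intro a b hab
            rw [SimpleGraph.fromRel_adj] at hab ⊢
            refine ⟨fun he => hab.1 ?_, hab.2.imp (fun hb => ?_) fun hb => ?_⟩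
            · have := congrArg (fun z => z.1.head?) he
              simpa [c] using this
            · exact ⟨i, b, l, rfl, .inr ⟨a, hb, rfl⟩⟩
            · exact ⟨i, a, l, rfl, .inr ⟨b, hb, rfl⟩⟩ }
      have hf : Function.Injective f := fun a b he => by
        have := congrArg (fun z => z.1.head?) he
        simpa [f, c] using this
      have hr := (hφ.comp_hom f hf).strictMonoOn_comp (f := (· - h * j)) (s := Set.Ici (h * j))
        (fun x hx y _ hxy => by
          have : h * j ≤ x := hx
          simp only
          omega) hlow
      have := hV (φ l₀ - h * j) _ (fun a => by
        have h1 := hi a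
        have h2 := hlow a
        change φ (c i a) - h * j < _
        omega) hr
      rw [mul_add_one]
      change _ ≤ φ l₀
      omega
  have h1 := key s [] (by simp)
  have h2 := hφk ⟨[], by simp⟩
  omega

/-- Isolated vertices bring the number of vertices to exactly `n`. -/
theorem ExistsHardGraph.exists_graph {t n h : ℕ} (hn : 1 ≤ n) (hG : ExistsHardGraph t n h) :
    ∃ H : SimpleGraph (Fin n), H.treewidth ≤ t ∧ h ≤ H.rankingNumber 2 := by
  obtain ⟨V, _, B, ord, hN, hB, hV⟩ := hG
  obtain ⟨f⟩ : Nonempty (V ↪ Fin n) :=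
    Function.Embedding.nonempty_of_card_le (by simpa using hN)
  have : Nonempty (Fin n) := ⟨⟨0, hn⟩⟩
  have hB' : IsElimination (Relation.Map B f f) (Function.extend f ord 0) t := by
    refine ⟨?_, ?_, fun v => ?_⟩
    · rintro _ _ ⟨u, v, huv, rfl, rfl⟩
      rw [f.injective.extend_apply, f.injective.extend_apply]
      exact hB.ord_lt huv
    · rintro _ _ w ⟨u, x, hu, rfl, rfl⟩ ⟨v, y, hv, rfl, h1⟩
      obtain rfl := f.injective h1
      rcases hB.clique hu hv with rfl | h2 | h2
      · exact .inl rfl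
      · exact .inr (.inl ⟨_, _, h2, rfl, rfl⟩)
      · exact .inr (.inr ⟨_, _, h2, rfl, rfl⟩)
    · by_cases hv : ∃ x, f x = v
      · obtain ⟨x, rfl⟩ := hv
        have hsub : {u | Relation.Map B f f u (f x)} ⊆ f '' {u | B u x} := by
          rintro _ ⟨u, y, hu, rfl, h1⟩
          obtain rfl := f.injective h1
          exact ⟨u, hu, rfl⟩
        exact (Set.ncard_le_ncard hsub (Set.toFinite _)).trans
          ((Set.ncard_image_le (Set.toFinite _)).trans (hB.card_le x))
      · have : {u | Relation.Map B f f u v} = ∅ := by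
          refine Set.eq_empty_of_forall_notMem ?_
          rintro _ ⟨u, y, hu, rfl, h1⟩
          exact hv ⟨y, h1⟩
        simp [this]
  let H := SimpleGraph.fromRel (Relation.Map B f f)
  refine ⟨H, hB'.treewidth_le fun u v huv => ((SimpleGraph.fromRel_adj _ _ _).1 huv).2, ?_⟩
  obtain ⟨φ, hφ, hr⟩ := H.exists_isRanking_rankingNumber 2
  let g : SimpleGraph.fromRel B →g H :=
    { toFun := f
      map_rel' := by
        intro a b hab
        rw [SimpleGraph.fromRel_adj] at hab ⊢
        exact ⟨fun he => hab.1 (f.injective he),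
          hab.2.imp (fun hb => ⟨_, _, hb, rfl, rfl⟩) fun hb => ⟨_, _, hb, rfl, rfl⟩⟩ }
  exact hV _ _ (fun v => hφ (f v)) (hr.comp_hom g f.injective)

/-! ### Iterated logarithms -/

open Filter

theorem iteratedLog_succ' (k : ℕ) (x : ℝ) : iteratedLog (k + 1) x = iteratedLog k (Real.log x) := by
  induction k with
  | zero => rfl
  | succ k ih => exact congrArg Real.log ih

theorem tendsto_iteratedLog (k : ℕ) : Tendsto (iteratedLog k) atTop atTop := by
  induction k with
  | zero => exact tendsto_id
  | succ k ih => exact Real.tendsto_log_atTop.comp ih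

theorem eventually_iteratedLog_le_self (k : ℕ) : ∀ᶠ x : ℝ in atTop, iteratedLog k x ≤ x := by
  induction k with
  | zero => exact .of_forall fun x => le_rfl
  | succ k ih =>
    filter_upwards [ih, (tendsto_iteratedLog k).eventually_ge_atTop 0] with x h1 h2
    exact (Real.log_le_self h2).trans h1

theorem eventually_iteratedLog_mono (k : ℕ) :
    ∀ᶠ x : ℝ in atTop, ∀ y, x ≤ y → iteratedLog k x ≤ iteratedLog k y := by
  induction k with
  | zero => exact .of_forall fun x y h => h
  | succ k ih =>
    filter_upwards [ih, (tendsto_iteratedLog k).eventually_gt_atTop 0] with x h1 h2 y hxy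
    exact Real.log_le_log h2 (h1 y hxy)

theorem eventually_iteratedLog_div_four_le (k : ℕ) :
    ∀ᶠ x : ℝ in atTop, ∀ y, x / 4 ≤ y → iteratedLog k x / 4 ≤ iteratedLog k y := by
  induction k with
  | zero => exact .of_forall fun x y h => h
  | succ k ih =>
    filter_upwards [ih, (tendsto_iteratedLog k).eventually_gt_atTop 0,
      (tendsto_iteratedLog (k + 1)).eventually_ge_atTop (2 * Real.log 4)] with x h1 h2 h3 y hxy
    have h4 := Real.log_le_log (by positivity) (h1 y hxy)
    rw [Real.log_div h2.ne' (by norm_num)] at h4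
    change 2 * Real.log 4 ≤ Real.log (iteratedLog k x) at h3
    change Real.log (iteratedLog k x) / 4 ≤ Real.log (iteratedLog k y)
    linarith [Real.log_nonneg (show (1 : ℝ) ≤ 4 by norm_num)]

theorem eventually_mul_log_le (c : ℝ) : ∀ᶠ x : ℝ in atTop, c * Real.log x ≤ x := by
  have h := Real.isLittleO_log_id_atTop.def (c := 1 / (|c| + 1)) (by positivity)
  filter_upwards [h, eventually_ge_atTop 1] with x hx h1
  rw [Real.norm_of_nonneg (Real.log_nonneg h1), id, Real.norm_of_nonneg (by linarith),
    one_div, inv_mul_eq_div, le_div_iff₀ (by positivity)] at hx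
  nlinarith [le_abs_self c, Real.log_nonneg h1]

theorem tendsto_log_natCast : Tendsto (fun n : ℕ => Real.log n) atTop atTop :=
  Real.tendsto_log_atTop.comp tendsto_natCast_atTop_atTop

/-! ### The upper bound -/

/-- Passing from `t` to `t + 1` with `D = ⌊√log M⌋`: the number of weight classes is about
`log M / log D`, each costs `log D / log⁽ᵗ⁺¹⁾ D` colours, and the ports only add `O(D)` colours. -/
theorem exists_colorBound.{u} (ℓ t : ℕ) : ∃ C : ℝ, 0 ≤ C ∧ ∀ᶠ M : ℕ in atTop, ∃ k : ℕ,
    ColorBound.{u} ℓ t M k ∧ (k : ℝ) ≤ C * (Real.log M / iteratedLog (t + 1) M) := by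
  induction t with
  | zero =>
    refine ⟨1, zero_le_one, ?_⟩
    filter_upwards [eventually_ge_atTop 2] with M hM
    refine ⟨1, colorBound_zero ℓ M, ?_⟩
    have : 0 < Real.log M := Real.log_pos (by exact_mod_cast hM)
    change ((1 : ℕ) : ℝ) ≤ 1 * (Real.log M / Real.log M)
    rw [div_self this.ne']
    simp
  | succ t ih =>
    obtain ⟨C, hC, ih⟩ := ih
    refine ⟨(ℓ + 1) * ((ℓ + 3) * C * 4 + (t + 1)), by positivity, ?_⟩
    have hs : Tendsto (fun M : ℕ => √(Real.log M)) atTop atTop :=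
      Real.tendsto_sqrt_atTop.comp tendsto_log_natCast
    have hD := tendsto_nat_floor_atTop.comp hs
    have hll : Tendsto (fun M : ℕ => Real.log (Real.log M)) atTop atTop :=
      Real.tendsto_log_atTop.comp tendsto_log_natCast
    filter_upwards [hD.eventually ih, hs.eventually_ge_atTop 4,
      hs.eventually (eventually_mul_log_le 2), hll.eventually (eventually_iteratedLog_div_four_le t),
      hll.eventually (eventually_iteratedLog_le_self t),
      hll.eventually ((tendsto_iteratedLog t).eventually_gt_atTop 0)]
      with M ihM hs4 hslog hfour hself hpos
    obtain ⟨F, hF, hFle⟩ := ihM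
    simp only [Function.comp] at hF hFle
    set s := √(Real.log M) with hsdef
    set D := ⌊s⌋₊ with hDdef
    have hx : Real.log M = s ^ 2 := by
      rw [hsdef, Real.sq_sqrt]
      by_contra! hneg
      rw [hsdef, Real.sqrt_eq_zero_of_nonpos hneg.le] at hs4
      norm_num at hs4
    have hDs : (D : ℝ) ≤ s := Nat.floor_le (by linarith)
    have hsD : s < D + 1 := Nat.lt_floor_add_one s
    have hD1 : 1 < D := by
      have : (1 : ℝ) < D := by linarith
      exact_mod_cast this
    refine ⟨_, hF.succ hD1, ?_⟩
    rw [iteratedLog_succ', iteratedLog_succ']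
    set I := iteratedLog t (Real.log (Real.log M)) with hI
    have hloglog : Real.log (Real.log M) = 2 * Real.log s := by
      rw [hx, Real.log_pow]; norm_num
    have hIs : I ≤ s := hself.trans (hloglog.trans_le hslog)
    have hlogD : Real.log (Real.log M) / 4 ≤ Real.log D := by
      have h1 : √s ≤ D := by
        have h2 : √s * √s = s := Real.mul_self_sqrt (by linarith)
        have h3 : 2 ≤ √s := Real.le_sqrt_of_sq_le (by linarith)
        nlinarith
      have h4 := Real.log_le_log (Real.sqrt_pos.2 (by linarith)) h1
      rw [Real.log_sqrt (by linarith)] at h4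
      linarith
    have hID : I / 4 ≤ iteratedLog (t + 1) D := by
      rw [iteratedLog_succ']; exact hfour _ hlogD
    have hlogDpos : 0 < Real.log D := Real.log_pos (by exact_mod_cast hD1)
    have hFle' : (F : ℝ) ≤ C * (Real.log D * 4 / I) := by
      refine hFle.trans (mul_le_mul_of_nonneg_left ?_ hC)
      rw [mul_div_assoc, div_eq_mul_inv]
      refine mul_le_mul_of_nonneg_left ?_ hlogDpos.le
      rw [show (4 : ℝ) / I = (I / 4)⁻¹ by rw [inv_div]]
      exact inv_anti₀ (by positivity) hID
    have hNL : (Nat.log D M : ℝ) ≤ Real.log M / Real.log D := Real.natLog_le_logb M D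
    have hone : 1 ≤ Real.log M / Real.log D := by
      rw [one_le_div hlogDpos, hx]
      have := Real.log_le_self (show (0 : ℝ) ≤ D by positivity)
      nlinarith
    have hA : ((ℓ + 2) * Nat.log D M + 1 : ℝ) ≤ (ℓ + 3) * (Real.log M / Real.log D) := by
      have : (ℓ + 2 : ℝ) * Nat.log D M ≤ (ℓ + 2) * (Real.log M / Real.log D) :=
        mul_le_mul_of_nonneg_left hNL (by positivity)
      linarith
    have hB : ((ℓ + 2) * Nat.log D M + 1 : ℝ) * F ≤ (ℓ + 3) * C * 4 * (Real.log M / I) := by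
      refine (mul_le_mul hA hFle' (by positivity) (by positivity)).trans_eq ?_
      field_simp
    have hD' : (D : ℝ) ≤ Real.log M / I := by
      rw [le_div_iff₀ hpos, hx, sq]
      exact mul_le_mul hDs hIs hpos.le (by linarith)
    push_cast
    rw [mul_assoc (ℓ + 1 : ℝ)]
    refine mul_le_mul_of_nonneg_left ?_ (by positivity)
    rw [add_mul ((ℓ + 3 : ℝ) * C * 4)]
    exact add_le_add hB (mul_le_mul_of_nonneg_left hD' (by positivity))

theorem exists_rankingNumber_le.{u} (ℓ t : ℕ) : ∃ C : ℝ, 0 ≤ C ∧ ∃ n₀ : ℕ,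
    ∀ (V : Type u) [Fintype V] (H : SimpleGraph V), n₀ ≤ Fintype.card V → H.treewidth ≤ t →
      (H.rankingNumber ℓ : ℝ) ≤
        C * (Real.log (Fintype.card V) / iteratedLog (t + 1) (Fintype.card V)) := by
  obtain ⟨C, hC, h⟩ := exists_colorBound.{u} ℓ t
  obtain ⟨n₀, h⟩ := eventually_atTop.1 h
  refine ⟨C, hC, n₀, fun V _ H hn hH => ?_⟩
  obtain ⟨k, hk, hle⟩ := h _ hn
  obtain ⟨B, ord, hB, hadj⟩ := SimpleGraph.exists_isElimination_of_treewidth_le hH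
  obtain ⟨φ, hφk, hφ⟩ := hk V B ord _ hB hB.isWeight_ncard fun v => by
    rw [← Nat.card_eq_fintype_card]
    exact Set.ncard_le_card _
  exact (Nat.cast_le.2 (SimpleGraph.rankingNumber_le (hB.isRanking hadj hφ) hφk)).trans hle

/-! ### The lower bound -/

theorem ExistsHardGraph.mono {t N N' h : ℕ} (hG : ExistsHardGraph t N h) (hN : N ≤ N') :
    ExistsHardGraph t N' h := by
  obtain ⟨V, i, B, ord, h1, h2⟩ := hG
  exact ⟨V, i, B, ord, h1.trans hN, h2⟩

theorem ExistsHardGraph.le {t N h : ℕ} (hN : 1 ≤ N) (hG : ExistsHardGraph t N h) : h ≤ N := by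
  obtain ⟨H, -, hH⟩ := hG.exists_graph hN
  refine hH.trans (SimpleGraph.rankingNumber_le (φ := Fin.val) (fun u v p hp h1 _ => ?_)
    fun v => v.is_lt)
  left
  intro huv
  obtain rfl := Fin.ext huv
  rw [SimpleGraph.Walk.isPath_iff_nil, ← SimpleGraph.Walk.length_eq_zero_iff] at hp
  omega

/-- Passing from `t` to `t + 1`: with `x = log n`, take copies of a graph on about `x` vertices and
words of length about `x / (4 log x)`. -/
theorem eventually_existsHardGraph (t : ℕ) : ∃ c : ℝ, 0 < c ∧ ∀ᶠ n : ℕ in atTop, ∃ h : ℕ,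
    ExistsHardGraph t n h ∧ c * (Real.log n / iteratedLog (t + 1) n) ≤ h := by
  induction t with
  | zero =>
    refine ⟨1, one_pos, ?_⟩
    filter_upwards [eventually_ge_atTop 1] with n hn
    refine ⟨1, existsHardGraph_zero hn, ?_⟩
    change 1 * (Real.log n / Real.log n) ≤ ((1 : ℕ) : ℝ)
    rw [one_mul, Nat.cast_one]
    exact div_self_le_one _
  | succ t ih =>
    obtain ⟨c, hc, ih⟩ := ih
    refine ⟨c / 16, by positivity, ?_⟩
    have hN := tendsto_nat_floor_atTop.comp tendsto_log_natCast
    have hNr := (tendsto_natCast_atTop_atTop (R := ℝ)).comp hN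
    have hll : Tendsto (fun M : ℕ => Real.log (Real.log M)) atTop atTop :=
      Real.tendsto_log_atTop.comp tendsto_log_natCast
    filter_upwards [hN.eventually ih, tendsto_log_natCast.eventually_ge_atTop 4,
      tendsto_log_natCast.eventually (eventually_mul_log_le 8), hll.eventually_ge_atTop 1,
      hNr.eventually (eventually_iteratedLog_mono (t + 1)),
      hNr.eventually ((tendsto_iteratedLog (t + 1)).eventually_gt_atTop 0), eventually_ge_atTop 1]
      with n ihn hx4 hx8 hlx hmono hpos hn1
    obtain ⟨h, hG, hle⟩ := ihn
    simp only [Function.comp] at hG hle hmono hpos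
    set x := Real.log n with hx
    set N := ⌊x⌋₊ with hNdef
    set s := ⌊x / (4 * Real.log x)⌋₊ with hs
    have hNx : (N : ℝ) ≤ x := Nat.floor_le (by linarith)
    have hxN : x < N + 1 := Nat.lt_floor_add_one x
    have hN1 : 1 ≤ N := Nat.le_floor (by norm_num; linarith)
    have hhN : (h : ℝ) ≤ x := (Nat.cast_le.2 (hG.le hN1)).trans hNx
    have hsx : (s : ℝ) ≤ x / (4 * Real.log x) := Nat.floor_le (by positivity)
    have hsx' : (s : ℝ) ≤ x := hsx.trans (div_le_self (by linarith) (by linarith))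
    have hxs : x / (4 * Real.log x) < s + 1 := Nat.lt_floor_add_one _
    refine ⟨h * s + 1, (hG.succ s).mono ?_, ?_⟩
    · have h1 : (((h * s + 1) * N + 1 : ℕ) : ℝ) ≤ x ^ 4 := by
        push_cast
        have h2 : (h : ℝ) * s ≤ x * x := mul_le_mul hhN hsx' (by positivity) (by linarith)
        have h3 : ((h : ℝ) * s + 1) * N ≤ (x * x + 1) * x :=
          mul_le_mul (by linarith) hNx (by positivity) (by positivity)
        have h4 : (4 : ℝ) * x ^ 3 ≤ x ^ 4 := by
          rw [pow_succ x 3, mul_comm]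
          exact mul_le_mul_of_nonneg_left hx4 (by positivity)
        nlinarith [sq_nonneg x]
      have h2 : x ^ (4 * s) ≤ n := by
        rw [← Real.log_le_log_iff (by positivity) (by exact_mod_cast hn1), Real.log_pow, ← hx]
        rw [le_div_iff₀ (by positivity)] at hsx
        push_cast
        linarith
      have h3 : ((((h * s + 1) * N + 1) ^ s : ℕ) : ℝ) ≤ n := by
        rw [Nat.cast_pow]
        refine (pow_le_pow_left₀ (by positivity) h1 s).trans ?_
        rwa [← pow_mul]
      exact_mod_cast h3
    · rw [iteratedLog_succ', ← hx]
      have hI : iteratedLog (t + 1) N ≤ iteratedLog (t + 1) x := hmono x hNx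
      set I := iteratedLog (t + 1) x with hIdef
      have hIpos : 0 < I := hpos.trans_le hI
      have hlogN : Real.log x / 2 ≤ Real.log N := by
        have h1 : √x ≤ N := by
          have h2 : √x * √x = x := Real.mul_self_sqrt (by linarith)
          have h3 : 2 ≤ √x := Real.le_sqrt_of_sq_le (by linarith)
          nlinarith
        have h4 := Real.log_le_log (Real.sqrt_pos.2 (by linarith)) h1
        rwa [Real.log_sqrt (by linarith)] at h4
      have hh : c * (Real.log x / 2 / I) ≤ h := by
        refine le_trans (mul_le_mul_of_nonneg_left ?_ hc.le) hle
        exact div_le_div₀ (by linarith) hlogN hpos hI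
      have hss : x / (8 * Real.log x) ≤ s := by
        have h1 : x / (4 * Real.log x) = 2 * (x / (8 * Real.log x)) := by field_simp; norm_num
        have h2 : 1 ≤ x / (8 * Real.log x) := by rwa [one_le_div (by positivity)]
        linarith
      have hprod : c * (Real.log x / 2 / I) * (x / (8 * Real.log x)) ≤ h * s :=
        mul_le_mul hh hss (by positivity) (by positivity)
      have heq : c * (Real.log x / 2 / I) * (x / (8 * Real.log x)) = c / 16 * (x / I) := by
        field_simp
        norm_num
      push_cast
      linarith

theorem theorem3 :
    (∀ ℓ t : ℕ, 2 ≤ ℓ → ∃ C : ℝ, ∃ n₀ : ℕ,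
      ∀ (V : Type*) [Fintype V] (H : SimpleGraph V),
        n₀ ≤ Fintype.card V → H.treewidth ≤ t →
        (H.rankingNumber ℓ : ℝ) ≤
          C * (Real.log (Fintype.card V) / iteratedLog (t + 1) (Fintype.card V))) ∧
    (∀ t : ℕ, ∃ c : ℝ, 0 < c ∧
      {n : ℕ | ∃ H : SimpleGraph (Fin n), H.treewidth = t ∧
        c * (Real.log n / iteratedLog (t + 1) n) ≤ (H.rankingNumber 2 : ℝ)}.Infinite) := by
  refine ⟨fun ℓ t _ => ?_, fun t => ?_⟩
  · obtain ⟨C, -, h⟩ := exists_rankingNumber_le ℓ t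
    exact ⟨C, h⟩
  obtain ⟨c, hc, h⟩ := eventually_existsHardGraph t
  refine ⟨c, hc, Nat.frequently_atTop_iff_infinite.1 (Eventually.frequently ?_)⟩
  cases t with
  | zero =>
    filter_upwards [h, eventually_ge_atTop 1] with n ⟨k, hk, hle⟩ hn
    obtain ⟨H, hH, hkH⟩ := hk.exists_graph hn
    have : Nonempty (Fin n) := ⟨⟨0, hn⟩⟩
    exact ⟨H, le_antisymm hH H.treewidth_nonneg, hle.trans (Nat.cast_le.2 hkH)⟩
  | succ t =>
    -- a graph of smaller treewidth would violate the upper bound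
    obtain ⟨C, hC, n₀, hup⟩ := exists_rankingNumber_le.{0} 2 t
    have hz := (tendsto_iteratedLog (t + 1)).comp (tendsto_natCast_atTop_atTop (R := ℝ))
    filter_upwards [h, eventually_ge_atTop 1, eventually_ge_atTop n₀,
      tendsto_log_natCast.eventually_gt_atTop 0,
      hz.eventually (eventually_mul_log_le (2 * C / c)), hz.eventually_gt_atTop 1]
      with n ⟨k, hk, hle⟩ hn hn₀ hlog hzlog hz1
    obtain ⟨H, hH, hkH⟩ := hk.exists_graph hn
    have hlow := hle.trans (Nat.cast_le.2 hkH)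
    refine ⟨H, le_antisymm hH ?_, hlow⟩
    by_contra! hlt
    have hHt : H.treewidth ≤ t := by push_cast at hlt; omega
    have h1 := hlow.trans (hup (Fin n) H (by simpa using hn₀) hHt)
    rw [Fintype.card_fin] at h1
    simp only [Function.comp] at hzlog hz1
    change c * (Real.log n / Real.log (iteratedLog (t + 1) n)) ≤ _ at h1
    set z := iteratedLog (t + 1) n with hzdef
    have hlz : 0 < Real.log z := Real.log_pos hz1
    have hz0 : 0 < z := by linarith
    rw [← mul_div_assoc, ← mul_div_assoc, div_le_div_iff₀ hlz hz0] at h1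
    have h2 : c * z ≤ C * Real.log z := by
      refine le_of_mul_le_mul_left ?_ hlog
      linarith
    rw [div_mul_eq_mul_div, div_le_iff₀ hc] at hzlog
    nlinarith [mul_pos hc hz0]
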